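/- Let $k$ be a field of characteristic zero and $R=k[x_0,x_1,x_2,x_3]$. Let $\mathcal A$ be a finite arrangement of distinct planes in $\mathbb P^3$, defined by pairwise non-proportional nonzero linear forms $L_1,\dots,L_d\in R$; put $F=L_1\cdots L_d$ and let $J=\langle \partial F/\partial x_0,\dots,\partial F/\partial x_3\rangle$ be its Jacobian ideal. Let $J=\mathfrak q_1\cap\dots\cap\mathfrak q_r$ be a minimal primary decomposition, and let $\overline J$ be the intersection of those $\mathfrak q_i$ that have height two (with $\overline J=R$ if there are none); these $\mathfrak q_i$ are called the components of $\overline J$, and such a component is called non-reduced if $\mathfrak q_i\neq\sqrt{\mathfrak q_i}$. Assume that no $L_j$ lies in the associated prime $\sqrt{\mathfrak q_i}$ of more than one non-reduced component $\mathfrak q_i$ of $\overline J$. Then $R/\overline J$ is a Cohen–Macaulay ring. That is, the subscheme $\overline C\subset\mathbb P^3$ defined by $\overline J$ is arithmetically Cohen–Macaulay: $R/I_{\overline C}$ is Cohen–Macaulay, where $I_{\overline C}$ is the saturation of $\overline J$ with respect to $(x_0,x_1,x_2,x_3)$. (The zero ring counts as Cohen–Macaulay.) -/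

import Mathlib

open MvPolynomial

/-- The depth of a local ring `A`: the supremum of the lengths of the `A`-regular sequences
contained in the maximal ideal. -/
noncomputable def localDepth (A : Type*) [CommRing A] [IsLocalRing A] : ℕ∞ :=
  ⨆ rs : {rs : List A // (∀ r ∈ rs, r ∈ IsLocalRing.maximalIdeal A) ∧
    RingTheory.Sequence.IsRegular A rs}, (rs.1.length : ℕ∞)

/-- A Noetherian ring is Cohen-Macaulay if each of its localizations at a maximal ideal has depth
equal to its Krull dimension. (The zero ring is Cohen-Macaulay.) -/
def IsCohenMacaulayRing (A : Type*) [CommRing A] : Prop :=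
  IsNoetherianRing A ∧ ∀ (m : Ideal A) [m.IsMaximal],
    (localDepth (Localization.AtPrime m) : WithBot ℕ∞) = ringKrullDim (Localization.AtPrime m)

section ProjectiveSpace

variable {k : Type*} [Field k] {n : ℕ}

/-- The forms `L i` are linear forms in `k[x₀, …, xₙ]` which define pairwise distinct hyperplanes
of `ℙⁿ`, that is, they are nonzero and pairwise linearly independent. -/
structure IsHyperplaneArrangement {d : ℕ} (L : Fin d → MvPolynomial (Fin (n + 1)) k) : Prop where
  linear : ∀ i, (L i).IsHomogeneous 1
  ne_zero : ∀ i, L i ≠ 0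
  distinct : ∀ i j, i ≠ j → LinearIndependent k ![L i, L j]

/-- The Jacobian ideal of a polynomial: the ideal generated by its first partial derivatives. -/
noncomputable def jacobianIdeal (F : MvPolynomial (Fin (n + 1)) k) :
    Ideal (MvPolynomial (Fin (n + 1)) k) :=
  Ideal.span (Set.range fun j => pderiv j F)

/-- The components of height two in a finite set `t` of ideals (a primary decomposition). -/
def heightTwoComponents (t : Finset (Ideal (MvPolynomial (Fin (n + 1)) k))) :
    Set (Ideal (MvPolynomial (Fin (n + 1)) k)) :=
  {q | q ∈ t ∧ q.height = 2}

/-- The intersection of the components of height two of a primary decomposition `t`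
(the unit ideal if there are none). -/
noncomputable def topDimensionalPart (t : Finset (Ideal (MvPolynomial (Fin (n + 1)) k))) :
    Ideal (MvPolynomial (Fin (n + 1)) k) :=
  sInf (heightTwoComponents t)

/-- The saturation of an ideal with respect to the irrelevant ideal `(x₀, …, xₙ)`. For a
homogeneous ideal `I` this is the saturated ideal of the subscheme of `ℙⁿ` defined by `I`. -/
noncomputable def saturation (I : Ideal (MvPolynomial (Fin (n + 1)) k)) :
    Ideal (MvPolynomial (Fin (n + 1)) k) :=
  ⨆ e : ℕ, I.colon
    ((Ideal.span (Set.range X) ^ e : Ideal (MvPolynomial (Fin (n + 1)) k)) :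
      Set (MvPolynomial (Fin (n + 1)) k))

/-- The subscheme of `ℙⁿ` defined by the homogeneous ideal `I` is arithmetically Cohen-Macaulay:
its homogeneous coordinate ring is a Cohen-Macaulay ring. -/
def DefinesACMScheme (I : Ideal (MvPolynomial (Fin (n + 1)) k)) : Prop :=
  IsCohenMacaulayRing (MvPolynomial (Fin (n + 1)) k ⧸ saturation I)

end ProjectiveSpace

/-!
The scheme structure of `topDimensionalPart t` is explicit. Its components are supported on the
lines in which two planes of the arrangement meet, and near such a line `P` the planes that do not
contain `P` are units; with Euler's identity this shows that the component along `P` is the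
Jacobian ideal of the product of the planes through `P` (`eq_lineComponent`). It is generated by
forms in the two transversal coordinates of `P`. It equals `P` if only two planes contain `P`, and
it lies in `P ^ 2`, so that it is not radical, if there are more; such lines are called multiple
here. By hypothesis each plane contains at most one multiple line, so the planes split into blocks
(the planes through a multiple line, and single planes), and planes of different blocks meet in
simple lines only.

The ideal of the union is built one block at a time by liaison addition: if `B` and `G` are the
products of the planes in the earlier blocks and in the new one, with ideals `I` and `q`, then the
ideal of the larger arrangement is `I ⊓ q ⊓ (B, G) = G * I + B * q`, and there is an exact
sequence `0 → R ⧸ I ⊕ R ⧸ q → R ⧸ (G * I + B * q) → R ⧸ (B, G) → 0`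
(`HasPrimeFiltration.liaison_addition`, `inf_inf_span_pair_eq`).

In place of depth, the induction carries the stronger property that `R ⧸ I` has a finite
filtration whose quotients are coordinate rings `R ⧸ P` of lines (`HasPrimeFiltration`). It holds
for the component along a line because that ideal is extended from an ideal of `k[y, z]` of finite
colength (`HasPrimeFiltration.map_of_pow_le`), and for the complete intersection `(B, G)` by
splitting off one plane at a time (`span_pair_prod`). Each `R ⧸ P` is a polynomial ring in two
variables. By prime avoidance every maximal ideal therefore contains a pair of elements that is
weakly regular on all the `R ⧸ P`, hence on `R ⧸ I`; as every prime ideal over `I` contains one of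
the `P`, the dimension is at most two (`HasPrimeFiltration.isCohenMacaulayRing_quotient`). The
filtration also shows that `I` is saturated, so the two conclusions of the theorem are the same.
-/

/-! ### Ideals with a prime filtration -/

/-- An ideal `I` has a prime filtration with factors in `S` if `R ⧸ I` has a finite filtration by
submodules whose successive quotients are of the form `R ⧸ P` with `P ∈ S`. It is encoded
inductively on ideals, by the exact sequences
`0 → R ⧸ (I : c) → R ⧸ I → R ⧸ (I + (c)) → 0`. -/
inductive HasPrimeFiltration {R : Type*} [CommRing R] (S : Set (Ideal R)) : Ideal R → Prop
  | top : HasPrimeFiltration S ⊤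
  | of_mem {P : Ideal R} (hP : P ∈ S) : HasPrimeFiltration S P
  | step {I K I' : Ideal R} (c : R) (hK : I ⊔ Ideal.span {c} = K) (hI' : I.colon {c} = I')
      (h₁ : HasPrimeFiltration S K) (h₂ : HasPrimeFiltration S I') : HasPrimeFiltration S I

namespace HasPrimeFiltration

variable {R : Type*} [CommRing R] {S S' : Set (Ideal R)} {I : Ideal R}

lemma mono (h : S ⊆ S') (hI : HasPrimeFiltration S I) : HasPrimeFiltration S' I := by
  induction hI with
  | top => exact .top
  | of_mem hP => exact .of_mem (h hP)
  | step c hK hI' _ _ h₁ h₂ => exact .step c hK hI' h₁ h₂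

/-- An ideal which lies in none of the factors `P ∈ S` annihilates no nonzero element of `R ⧸ I`. -/
lemma mem_of_forall_mul_mem (hI : HasPrimeFiltration S I) {𝔞 : Ideal R}
    (h𝔞 : ∀ P ∈ S, P.IsPrime ∧ ¬ 𝔞 ≤ P) {x : R} (hx : ∀ a ∈ 𝔞, a * x ∈ I) : x ∈ I := by
  induction hI generalizing x with
  | top => trivial
  | of_mem hP =>
    obtain ⟨hp, hn⟩ := h𝔞 _ hP
    obtain ⟨a, ha, haP⟩ := SetLike.not_le_iff_exists.1 hn
    exact (hp.mem_or_mem (hx a ha)).resolve_left haP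
  | @step I K I' c hK hI' _ _ ih₁ ih₂ =>
    subst hK hI'
    have h := ih₁ fun a ha ↦ Ideal.mem_sup_left (hx a ha)
    obtain ⟨i, hi, z, hz, rfl⟩ := Submodule.mem_sup.1 h
    obtain ⟨r, rfl⟩ := Ideal.mem_span_singleton'.1 hz
    refine I.add_mem hi (Submodule.mem_colon_singleton.1 (ih₂ fun a ha ↦ ?_))
    rw [Submodule.mem_colon_singleton, smul_eq_mul]
    have := I.sub_mem (hx a ha) (I.mul_mem_left a hi)
    convert this using 1
    ring

/-- An element outside all the factors `P ∈ S` is a nonzerodivisor on `R ⧸ I`. -/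
lemma mem_of_mul_mem (hI : HasPrimeFiltration S I) {s : R}
    (hs : ∀ P ∈ S, P.IsPrime ∧ s ∉ P) {x : R} (hx : s * x ∈ I) : x ∈ I :=
  hI.mem_of_forall_mul_mem (𝔞 := Ideal.span {s})
    (fun P hP ↦ ⟨(hs P hP).1, by simpa [Ideal.span_singleton_le_iff_mem] using (hs P hP).2⟩)
    fun a ha ↦ by
      obtain ⟨r, rfl⟩ := Ideal.mem_span_singleton'.1 ha
      rw [mul_assoc]
      exact I.mul_mem_left _ hx

/-- If `a, b` is a weakly regular sequence on `R ⧸ P` for all factors `P ∈ S`, then it is one on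
`R ⧸ I`. The first condition is `mem_of_mul_mem`; this is the second, that `b` is a nonzerodivisor
on `R ⧸ (I + (a))`. -/
lemma mem_sup_of_mul_mem_sup (hI : HasPrimeFiltration S I) {a b : R}
    (ha : ∀ P ∈ S, P.IsPrime ∧ a ∉ P)
    (hb : ∀ P ∈ S, ∀ x, b * x ∈ P ⊔ Ideal.span {a} → x ∈ P ⊔ Ideal.span {a})
    {x : R} (hx : b * x ∈ I ⊔ Ideal.span {a}) : x ∈ I ⊔ Ideal.span {a} := by
  induction hI generalizing x with
  | top => simp
  | of_mem hP => exact hb _ hP x hx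
  | @step I K I' c hK hI' h₁ h₂ ih₁ ih₂ =>
    subst hK hI'
    have hle : I ⊔ Ideal.span {a} ≤ I ⊔ Ideal.span {c} ⊔ Ideal.span {a} :=
      sup_le_sup_right le_sup_left _
    have h := ih₁ (hle hx)
    obtain ⟨w, hw, z, hz, rfl⟩ := Submodule.mem_sup.1 h
    obtain ⟨i, hi, u, hu, rfl⟩ := Submodule.mem_sup.1 hw
    obtain ⟨r, rfl⟩ := Ideal.mem_span_singleton'.1 hu
    obtain ⟨y, rfl⟩ := Ideal.mem_span_singleton'.1 hz
    obtain ⟨i₁, hi₁, z₁, hz₁, e⟩ := Submodule.mem_sup.1 hx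
    obtain ⟨y₁, rfl⟩ := Ideal.mem_span_singleton'.1 hz₁
    -- Since `a` is a nonzerodivisor modulo `I + (c)`, the coefficient of `a` can be moved there.
    have h3 : y₁ - b * y ∈ I ⊔ Ideal.span {c} := by
      refine h₁.mem_of_mul_mem ha ?_
      refine Submodule.mem_sup.2 ⟨b * i - i₁, I.sub_mem (I.mul_mem_left _ hi) hi₁, b * r * c,
        Ideal.mem_span_singleton'.2 ⟨b * r, rfl⟩, ?_⟩
      linear_combination -e
    obtain ⟨i₂, hi₂, v, hv, e₂⟩ := Submodule.mem_sup.1 h3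
    obtain ⟨r₂, rfl⟩ := Ideal.mem_span_singleton'.1 hv
    have h4 : b * r - a * r₂ ∈ I.colon {c} := by
      rw [Submodule.mem_colon_singleton, smul_eq_mul]
      have := I.add_mem (I.sub_mem hi₁ (I.mul_mem_left b hi)) (I.mul_mem_left a hi₂)
      convert this using 1
      linear_combination -e - a * e₂
    have h5 : r ∈ I.colon {c} ⊔ Ideal.span {a} := by
      refine ih₂ (Submodule.mem_sup.2 ⟨_, h4, r₂ * a, Ideal.mem_span_singleton'.2 ⟨r₂, rfl⟩, ?_⟩)
      ring
    obtain ⟨j, hj, q, hq, rfl⟩ := Submodule.mem_sup.1 h5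
    obtain ⟨y₃, rfl⟩ := Ideal.mem_span_singleton'.1 hq
    rw [Submodule.mem_colon_singleton, smul_eq_mul] at hj
    refine Submodule.mem_sup.2 ⟨i + j * c, I.add_mem hi hj, (y₃ * c + y) * a,
      Ideal.mem_span_singleton'.2 ⟨_, rfl⟩, ?_⟩
    ring

lemma exists_le_of_isPrime (hI : HasPrimeFiltration S I) {Q : Ideal R} (hQ : Q.IsPrime)
    (h : I ≤ Q) : ∃ P ∈ S, P ≤ Q := by
  induction hI with
  | top => exact (hQ.ne_top (top_le_iff.1 h)).elim
  | of_mem hP => exact ⟨_, hP, h⟩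
  | @step I K I' c hK hI' _ _ ih₁ ih₂ =>
    subst hK hI'
    by_cases hc : I.colon {c} ≤ Q
    · exact ih₂ hc
    · obtain ⟨r, hr, hrQ⟩ := SetLike.not_le_iff_exists.1 hc
      rw [Submodule.mem_colon_singleton, smul_eq_mul] at hr
      refine ih₁ (sup_le h ?_)
      rw [Ideal.span_singleton_le_iff_mem]
      exact (hQ.mem_or_mem (h hr)).resolve_left hrQ

/-- If `f : T → R` commutes with forming colon ideals by elements (for instance, if `f` is flat),
then the extension of an ideal `𝔠` that contains a power of the maximal ideal `𝔪` is filtered by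
copies of `R ⧸ 𝔪R`: extend a composition series of `T ⧸ 𝔠`. -/
lemma map_of_pow_le {T : Type*} [CommRing T] [IsNoetherianRing T] (f : T →+* R)
    (hf : ∀ (𝔠 : Ideal T) (c : T), (𝔠.map f).colon {f c} ≤ (𝔠.colon {c}).map f)
    {𝔪 : Ideal T} (h𝔪 : 𝔪.IsMaximal) {N : ℕ} {𝔠 : Ideal T} (h𝔠 : 𝔪 ^ N ≤ 𝔠) :
    HasPrimeFiltration {𝔪.map f} (𝔠.map f) := by
  induction 𝔠 using WellFoundedGT.induction with
  | ind 𝔠 ih =>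
  by_cases htop : 𝔠 = ⊤
  · subst htop
    rw [Ideal.map_top]
    exact .top
  classical
  -- The element `c` generates a simple submodule of `T ⧸ 𝔠`.
  have hex : ∃ e, 𝔪 ^ e ≤ 𝔠 := ⟨N, h𝔠⟩
  have he := Nat.find_spec hex
  obtain ⟨e, hefind⟩ : ∃ e, Nat.find hex = e + 1 := by
    refine Nat.exists_eq_succ_of_ne_zero fun h0 ↦ htop ?_
    rw [h0, pow_zero, Ideal.one_eq_top] at he
    exact top_le_iff.1 he
  have hmin : ¬ 𝔪 ^ e ≤ 𝔠 := Nat.find_min hex (by omega)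
  rw [hefind] at he
  obtain ⟨c, hc, hc𝔠⟩ := SetLike.not_le_iff_exists.1 hmin
  have hcolon : 𝔠.colon {c} = 𝔪 := by
    refine (h𝔪.eq_of_le ?_ fun x hx ↦ ?_).symm
    · intro h
      have : (1 : T) ∈ 𝔠.colon {c} := h ▸ trivial
      rw [Submodule.mem_colon_singleton, one_smul] at this
      exact hc𝔠 this
    · rw [Submodule.mem_colon_singleton, smul_eq_mul]
      refine he ?_
      rw [pow_succ']
      exact Ideal.mul_mem_mul hx hc
  refine .step (f c) (K := (𝔠 ⊔ Ideal.span {c}).map f) (I' := 𝔪.map f) ?_ ?_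
    (ih _ ?_ (h𝔠.trans le_sup_left)) (.of_mem rfl)
  · rw [Ideal.map_sup, Ideal.map_span, Set.image_singleton]
  · refine le_antisymm ((hf 𝔠 c).trans_eq (by rw [hcolon])) ?_
    rw [← hcolon, Ideal.map_le_iff_le_comap]
    intro x hx
    rw [Submodule.mem_colon_singleton, smul_eq_mul] at hx
    rw [Ideal.mem_comap, Submodule.mem_colon_singleton, smul_eq_mul, ← map_mul]
    exact Ideal.mem_map_of_mem f hx
  · exact left_lt_sup.2 (by rwa [Ideal.span_singleton_le_iff_mem])

end HasPrimeFiltration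

/-! ### Liaison addition and complete intersections -/

section Liaison

variable {R : Type*} [CommRing R] {S : Set (Ideal R)}

/-- Liaison addition (Schwartau): for a regular sequence `B ∈ I`, `G ∈ q`, the quotients of the
filtration `G * I + B * q ⊆ (G) + B * q ⊆ (B, G) ⊆ R` are `R ⧸ I`, `R ⧸ q` and `R ⧸ (B, G)`. -/
lemma HasPrimeFiltration.liaison_addition [DecompositionMonoid R] {I q : Ideal R}
    {B G : R} (hI : HasPrimeFiltration S I) (hq : HasPrimeFiltration S q)
    (hBG : HasPrimeFiltration S (Ideal.span {B, G})) (hB : B ∈ I) (hG : G ∈ q)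
    (hrel : IsRelPrime B G) :
    HasPrimeFiltration S (Ideal.span {G} * I ⊔ Ideal.span {B} * q) := by
  have h₁ : Ideal.span {G} * I ⊔ Ideal.span {B} * q ⊔ Ideal.span {G} =
      Ideal.span {G} ⊔ Ideal.span {B} * q := by
    have : Ideal.span {G} * I ≤ Ideal.span {G} := Ideal.mul_le_left
    rw [sup_right_comm, sup_eq_right.2 this]
  have h₂ : Ideal.span {G} ⊔ Ideal.span {B} * q ⊔ Ideal.span {B} = Ideal.span {B, G} := by
    have : Ideal.span {B} * q ≤ Ideal.span {B} := Ideal.mul_le_left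
    rw [sup_assoc, sup_eq_right.2 this, Ideal.span_insert, sup_comm]
  refine .step G h₁ ?_ (.step B h₂ ?_ hBG hq) hI
  · ext x
    rw [Submodule.mem_colon_singleton, smul_eq_mul]
    constructor
    · intro h
      obtain ⟨y, hy, z, hz, e⟩ := Submodule.mem_sup.1 h
      obtain ⟨i, hi, rfl⟩ := Ideal.mem_span_singleton_mul.1 hy
      obtain ⟨j, hj, rfl⟩ := Ideal.mem_span_singleton_mul.1 hz
      have hdvd : B ∣ x - i := hrel.dvd_of_dvd_mul_right ⟨j, by linear_combination -e⟩
      have := I.add_mem (I.mem_of_dvd hdvd hB) hi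
      simpa using this
    · intro h
      exact Ideal.mem_sup_left (Ideal.mem_span_singleton_mul.2 ⟨x, h, mul_comm _ _⟩)
  · ext x
    rw [Submodule.mem_colon_singleton, smul_eq_mul]
    constructor
    · intro h
      obtain ⟨y, hy, z, hz, e⟩ := Submodule.mem_sup.1 h
      obtain ⟨i, rfl⟩ := Ideal.mem_span_singleton'.1 hy
      obtain ⟨j, hj, rfl⟩ := Ideal.mem_span_singleton_mul.1 hz
      have hdvd : G ∣ x - j := hrel.symm.dvd_of_dvd_mul_right ⟨i, by linear_combination -e⟩
      have := q.add_mem (q.mem_of_dvd hdvd hG) hj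
      simpa using this
    · intro h
      exact Ideal.mem_sup_right (Ideal.mem_span_singleton_mul.2 ⟨x, h, mul_comm _ _⟩)

/-- The ideal produced by liaison addition is the ideal of the union. -/
lemma inf_inf_span_pair_eq {I q : Ideal R} {B G : R} (hB : B ∈ I) (hG : G ∈ q)
    (hGI : ∀ x, G * x ∈ I → x ∈ I) (hBq : ∀ x, B * x ∈ q → x ∈ q) :
    I ⊓ q ⊓ Ideal.span {B, G} = Ideal.span {G} * I ⊔ Ideal.span {B} * q := by
  refine le_antisymm ?_ (sup_le ?_ ?_)
  · rintro x ⟨⟨hxI, hxq⟩, hx⟩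
    obtain ⟨a, b, rfl⟩ := Ideal.mem_span_pair.1 hx
    have hb : b ∈ I := hGI b (by
      have := I.sub_mem hxI (I.mul_mem_left a hB)
      convert this using 1
      ring)
    have ha : a ∈ q := hBq a (by
      have := q.sub_mem hxq (q.mul_mem_left b hG)
      convert this using 1
      ring)
    rw [add_comm]
    exact Submodule.add_mem_sup (Ideal.mem_span_singleton_mul.2 ⟨b, hb, mul_comm _ _⟩)
      (Ideal.mem_span_singleton_mul.2 ⟨a, ha, mul_comm _ _⟩)
  · refine le_inf (le_inf Ideal.mul_le_right (Ideal.mul_le_left.trans ?_))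
      (Ideal.mul_le_left.trans ?_)
    · rwa [Ideal.span_singleton_le_iff_mem]
    · exact Ideal.span_mono (by simp)
  · refine le_inf (le_inf (Ideal.mul_le_left.trans ?_) Ideal.mul_le_right)
      (Ideal.mul_le_left.trans ?_)
    · rwa [Ideal.span_singleton_le_iff_mem]
    · exact Ideal.span_mono (by simp)

/-- If `f` and `g` are coprime, then `R ⧸ (f * f', g)` is an extension of `R ⧸ (f, g)` by
`R ⧸ (f', g)`. -/
lemma HasPrimeFiltration.span_pair_mul [IsDomain R] [DecompositionMonoid R] {f f' g : R}
    (hf : f ≠ 0) (hrel : IsRelPrime f g) (h : HasPrimeFiltration S (Ideal.span {f, g}))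
    (h' : HasPrimeFiltration S (Ideal.span {f', g})) :
    HasPrimeFiltration S (Ideal.span {f * f', g}) := by
  refine .step f ?_ ?_ h h'
  · refine le_antisymm (sup_le (Ideal.span_le.2 ?_) (Ideal.span_mono (by simp)))
      (Ideal.span_le.2 ?_)
    · rintro x (rfl | rfl)
      · exact Ideal.mul_mem_right _ _ (Ideal.subset_span (by simp))
      · exact Ideal.subset_span (by simp)
    · rintro x (rfl | rfl)
      · exact Ideal.mem_sup_right (Ideal.subset_span rfl)
      · exact Ideal.mem_sup_left (Ideal.subset_span (by simp))
  · ext x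
    rw [Submodule.mem_colon_singleton, smul_eq_mul, Ideal.mem_span_pair, Ideal.mem_span_pair]
    constructor
    · rintro ⟨a, b, e⟩
      obtain ⟨c, rfl⟩ : f ∣ b :=
        hrel.dvd_of_dvd_mul_right ⟨x - a * f', by linear_combination e⟩
      exact ⟨a, c, mul_left_cancel₀ hf (by linear_combination e)⟩
    · rintro ⟨a, b, rfl⟩
      exact ⟨a, b * f, by ring⟩

lemma mem_span_pair_mul {f f' g x : R} (hnzd : ∀ y, f * y ∈ Ideal.span {f', g} →
    y ∈ Ideal.span {f', g}) (h : x ∈ Ideal.span {f, g}) (h' : x ∈ Ideal.span {f', g}) :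
    x ∈ Ideal.span {f * f', g} := by
  obtain ⟨a, b, rfl⟩ := Ideal.mem_span_pair.1 h
  have ha : f * a ∈ Ideal.span {f', g} := by
    have := Ideal.sub_mem _ h' (Ideal.mul_mem_left _ b (Ideal.subset_span (by simp :
      g ∈ ({f', g} : Set R))))
    convert this using 1
    ring
  obtain ⟨c, e, rfl⟩ := Ideal.mem_span_pair.1 (hnzd a ha)
  exact Ideal.mem_span_pair.2 ⟨c, e * f + b, by ring⟩

variable {ι : Type*} (L : ι → R)

/-- Two products of planes that meet along pairwise distinct lines `L a = L b = 0` form a complete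
intersection, which is the union of these lines and is filtered by their coordinate rings. -/
lemma span_pair_prod [IsDomain R] [DecompositionMonoid R] (U V : Finset ι)
    (h0 : ∀ i, L i ≠ 0) (hrel : ∀ a ∈ U, ∀ b ∈ V, IsRelPrime (L a) (L b))
    (hprime : ∀ a ∈ U, ∀ b ∈ V, (Ideal.span {L a, L b}).IsPrime)
    (hU : ∀ a ∈ U, ∀ a' ∈ U, ∀ b ∈ V, a ≠ a' → L a ∉ Ideal.span {L a', L b})
    (hV : ∀ a ∈ U, ∀ b ∈ V, ∀ b' ∈ V, b ≠ b' → L b ∉ Ideal.span {L a, L b'}) :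
    HasPrimeFiltration {P | ∃ a ∈ U, ∃ b ∈ V, P = Ideal.span {L a, L b}}
      (Ideal.span {∏ i ∈ U, L i, ∏ i ∈ V, L i}) ∧
    ∀ x, (∀ a ∈ U, ∀ b ∈ V, x ∈ Ideal.span {L a, L b}) →
      x ∈ Ideal.span {∏ i ∈ U, L i, ∏ i ∈ V, L i} := by
  classical
  -- The case of a single plane on one side.
  have key : ∀ g, ∀ W : Finset ι, (∀ a ∈ W, IsRelPrime (L a) g) →
      ∀ J : ι → Set (Ideal R), (∀ a ∈ W, HasPrimeFiltration (J a) (Ideal.span {L a, g})) →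
      (∀ a ∈ W, ∀ a' ∈ W, a ≠ a' → ∀ P ∈ J a', P.IsPrime ∧ L a ∉ P) →
      HasPrimeFiltration (⋃ a ∈ W, J a) (Ideal.span {∏ i ∈ W, L i, g}) ∧
      ∀ x, (∀ a ∈ W, x ∈ Ideal.span {L a, g}) → x ∈ Ideal.span {∏ i ∈ W, L i, g} := by
    intro g W
    induction W using Finset.induction_on with
    | empty =>
      intro _ J _ _
      have : Ideal.span {∏ i ∈ (∅ : Finset ι), L i, g} = ⊤ := by
        rw [Ideal.eq_top_iff_one]
        exact Ideal.subset_span (by simp)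
      rw [this]
      exact ⟨.top, fun _ _ ↦ trivial⟩
    | insert a W ha ih =>
      intro hr J hJ hn
      obtain ⟨ih₁, ih₂⟩ := ih (fun b hb ↦ hr b (Finset.mem_insert_of_mem hb)) J
        (fun b hb ↦ hJ b (Finset.mem_insert_of_mem hb))
        (fun b hb c hc ↦ hn b (Finset.mem_insert_of_mem hb) c (Finset.mem_insert_of_mem hc))
      rw [Finset.prod_insert ha]
      have hsub : (⋃ b ∈ W, J b) ⊆ ⋃ b ∈ insert a W, J b :=
        Set.biUnion_subset_biUnion_left fun b hb ↦ Finset.mem_insert_of_mem hb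
      have hsub' : J a ⊆ ⋃ b ∈ insert a W, J b :=
        Set.subset_biUnion_of_mem (u := J) (Finset.mem_insert_self a W)
      refine ⟨.span_pair_mul (h0 a) (hr a (Finset.mem_insert_self a W))
        ((hJ a (Finset.mem_insert_self a W)).mono hsub') (ih₁.mono hsub), fun x hx ↦ ?_⟩
      refine mem_span_pair_mul (fun y hy ↦ ih₁.mem_of_mul_mem (fun P hP ↦ ?_) hy)
        (hx a (Finset.mem_insert_self a W)) (ih₂ x fun b hb ↦ hx b (Finset.mem_insert_of_mem hb))
      simp only [Set.mem_iUnion] at hP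
      obtain ⟨b, hb, hP⟩ := hP
      exact hn a (Finset.mem_insert_self a W) b (Finset.mem_insert_of_mem hb)
        (fun h ↦ ha (h ▸ hb)) P hP
  have h₁ : ∀ b ∈ V, HasPrimeFiltration (⋃ a ∈ U, {Ideal.span {L a, L b}})
      (Ideal.span {∏ i ∈ U, L i, L b}) ∧
      ∀ x, (∀ a ∈ U, x ∈ Ideal.span {L a, L b}) → x ∈ Ideal.span {∏ i ∈ U, L i, L b} := by
    intro b hb
    refine key (L b) U (fun a ha ↦ hrel a ha b hb) (fun a ↦ {Ideal.span {L a, L b}})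
      (fun a _ ↦ .of_mem rfl) ?_
    rintro a ha a' ha' hne P rfl
    exact ⟨hprime a' ha' b hb, hU a ha a' ha' b hb hne⟩
  have h₂ := key (∏ i ∈ U, L i) V
    (fun b hb ↦ IsRelPrime.prod_right fun a ha ↦ (hrel a ha b hb).symm)
    (fun b ↦ ⋃ a ∈ U, {Ideal.span {L a, L b}})
    (fun b hb ↦ by rw [Set.pair_comm]; exact (h₁ b hb).1) ?_
  · refine ⟨?_, fun x hx ↦ ?_⟩
    · rw [Set.pair_comm]
      refine h₂.1.mono fun P hP ↦ ?_
      simp only [Set.mem_iUnion, Set.mem_singleton_iff] at hP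
      obtain ⟨b, hb, a, ha, rfl⟩ := hP
      exact ⟨a, ha, b, hb, rfl⟩
    · rw [Set.pair_comm]
      refine h₂.2 x fun b hb ↦ ?_
      rw [Set.pair_comm]
      exact (h₁ b hb).2 x fun a ha ↦ hx a ha b hb
  · intro b hb b' hb' hne P hP
    simp only [Set.mem_iUnion, Set.mem_singleton_iff] at hP
    obtain ⟨a, ha, rfl⟩ := hP
    exact ⟨hprime a ha b' hb', hV a ha b hb b' hb' hne⟩

end Liaison

/-! ### The Cohen-Macaulay property -/

section CohenMacaulay

open RingTheory.Sequence
open scoped Pointwise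

/-- In a factorial ring the minimal primes of a nonzero principal ideal `(a)` are generated by the
prime factors of `a`. -/
lemma isRelPrime_of_notMem_minimalPrimes {U : Type*} [CommRing U] [IsDomain U]
    [UniqueFactorizationMonoid U] {a b : U} (ha : a ≠ 0)
    (hb : ∀ Q ∈ (Ideal.span {a}).minimalPrimes, b ∉ Q) : IsRelPrime a b := by
  rw [UniqueFactorizationMonoid.isRelPrime_iff_no_prime_factors ha]
  intro p hpa hpb hp
  have hprime : (Ideal.span {p}).IsPrime := (Ideal.span_singleton_prime hp.ne_zero).2 hp
  have hle : Ideal.span {a} ≤ Ideal.span {p} := Ideal.span_singleton_le_span_singleton.2 hpa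
  obtain ⟨Q, hQ, hQp⟩ := Ideal.exists_minimalPrimes_le hle
  have hQprime : Q.IsPrime := hQ.1.1
  -- A nonzero prime ideal contained in `(p)` is equal to `(p)`.
  obtain ⟨p', hp'Q, hp'⟩ := hQprime.exists_mem_prime_of_ne_bot (by
    rintro rfl
    exact ha (by simpa using hQ.1.2))
  have hdvd : p ∣ p' := Ideal.mem_span_singleton.1 (hQp hp'Q)
  have hdvd' : p' ∣ p := (hp.associated_of_dvd hp' hdvd).symm.dvd
  exact hb Q hQ (Q.mem_of_dvd (hdvd'.trans hpb) hp'Q)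

/-- Prime avoidance: a maximal ideal `M` contains two elements that form a weakly regular sequence
on each of finitely many two-dimensional factorial quotients `R ⧸ P`. -/
lemma exists_pair_of_isMaximal {R : Type*} [CommRing R] [IsNoetherianRing R] {S : Set (Ideal R)}
    (hfin : S.Finite) (hprime : ∀ P ∈ S, P.IsPrime)
    (hUFD : ∀ P ∈ S, ∀ _ : IsDomain (R ⧸ P), UniqueFactorizationMonoid (R ⧸ P))
    (hht : ∀ P ∈ S, ∀ 𝔫 : Ideal (R ⧸ P), 𝔫.IsMaximal → 𝔫.height = 2)
    {M : Ideal R} (hM : M.IsMaximal) :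
    ∃ a ∈ M, ∃ b ∈ M, (∀ P ∈ S, a ∉ P) ∧
      ∀ P ∈ S, ∀ x, b * x ∈ P ⊔ Ideal.span {a} → x ∈ P ⊔ Ideal.span {a} := by
  classical
  -- Avoid a finite set of primes, none of which is equal to `M`.
  have avoid : ∀ T : Set (Ideal R), T.Finite → (∀ Q ∈ T, Q.IsPrime ∧ ¬ Q.IsMaximal) →
      ∃ a ∈ M, ∀ Q ∈ T, a ∉ Q := by
    intro T hT h
    by_contra! hcon
    have hsub : (M : Set R) ⊆ ⋃ Q ∈ ((hT.toFinset : Finset (Ideal R)) : Set (Ideal R)),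
        ((fun Q : Ideal R ↦ Q) Q : Set R) := by
      intro a ha
      obtain ⟨Q, hQ, haQ⟩ := hcon a ha
      simp only [Set.mem_iUnion]
      exact ⟨Q, by simpa using hQ, haQ⟩
    obtain ⟨Q, hQ, hle⟩ := (Ideal.subset_union_prime ⊥ ⊥
      (fun Q hQ _ _ ↦ (h Q (by simpa using hQ)).1)).1 hsub
    have hQ' : Q ∈ T := by simpa using hQ
    exact (h Q hQ').2 (hM.eq_of_le (h Q hQ').1.ne_top hle ▸ hM)
  obtain ⟨a, haM, ha⟩ := avoid S hfin fun P hP ↦ ⟨hprime P hP, fun hmax ↦ by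
    have : (⊥ : Ideal (R ⧸ P)).IsMaximal := Ideal.bot_quotient_isMaximal_iff P |>.2 hmax
    have h2 := hht P hP ⊥ this
    have := hprime P hP
    rw [Ideal.height_bot] at h2
    simp at h2⟩
  let T : Set (Ideal R) := ⋃ P ∈ S, (fun Q ↦ Q.comap (Ideal.Quotient.mk P)) ''
    (Ideal.span {Ideal.Quotient.mk P a}).minimalPrimes
  obtain ⟨b, hbM, hb⟩ := avoid T
    (hfin.biUnion fun P _ ↦ (Ideal.finite_minimalPrimes_of_isNoetherianRing _ _).image _) (by
    intro Q hQ
    simp only [T, Set.mem_iUnion, Set.mem_image] at hQ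
    obtain ⟨P, hP, Q, hQ, rfl⟩ := hQ
    have hQp : Q.IsPrime := hQ.1.1
    refine ⟨Ideal.comap_isPrime _ _, fun hmax ↦ ?_⟩
    have hQmax : Q.IsMaximal := by
      have := Ideal.IsMaximal.map_of_surjective_of_ker_le (f := Ideal.Quotient.mk P)
        Ideal.Quotient.mk_surjective (m := Q.comap (Ideal.Quotient.mk P)) (by
          exact Ideal.comap_mono bot_le)
      rwa [Ideal.map_comap_of_surjective _ Ideal.Quotient.mk_surjective] at this
    have h1 : Q.height ≤ 1 := Ideal.height_le_one_of_isPrincipal_of_mem_minimalPrimes _ _ hQ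
    rw [hht P hP Q hQmax] at h1
    exact absurd h1 (by decide))
  refine ⟨a, haM, b, hbM, ha, fun P hP x hx ↦ ?_⟩
  have := hprime P hP
  have hdom : IsDomain (R ⧸ P) := inferInstance
  have := hUFD P hP hdom
  have hmem : ∀ y, y ∈ P ⊔ Ideal.span {a} ↔
      Ideal.Quotient.mk P a ∣ Ideal.Quotient.mk P y := by
    intro y
    rw [← Ideal.mem_span_singleton, ← Set.image_singleton, ← Ideal.map_span,
      ← Ideal.mem_comap, Ideal.comap_map_of_surjective' _ Ideal.Quotient.mk_surjective,
      Ideal.mk_ker, sup_comm]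
  rw [hmem] at hx ⊢
  rw [map_mul] at hx
  have hrel : IsRelPrime (Ideal.Quotient.mk P a) (Ideal.Quotient.mk P b) := by
    refine isRelPrime_of_notMem_minimalPrimes ?_ fun Q hQ hbQ ↦ ?_
    · rw [Ne, Ideal.Quotient.eq_zero_iff_mem]
      exact ha P hP
    · refine hb (Q.comap (Ideal.Quotient.mk P)) ?_ hbQ
      simp only [T, Set.mem_iUnion]
      exact ⟨P, hP, Q, hQ, rfl⟩
  exact hrel.dvd_of_dvd_mul_left hx

lemma localDepth_le_ringKrullDim (A : Type*) [CommRing A] [IsLocalRing A] [IsNoetherianRing A] :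
    (localDepth A : WithBot ℕ∞) ≤ ringKrullDim A := by
  have h0 : ringKrullDim A = ((ringKrullDim A).unbot ringKrullDim_ne_bot : ℕ∞) :=
    (WithBot.coe_unbot _ _).symm
  rw [h0, WithBot.coe_le_coe, localDepth]
  refine iSup_le fun ⟨rs, hmem, hreg⟩ ↦ ?_
  rw [← WithBot.coe_le_coe, ← h0, ← ringKrullDim_add_length_eq_ringKrullDim_of_isRegular rs hreg]
  have hnt : Nontrivial (A ⧸ Ideal.ofList rs) := by
    refine Ideal.Quotient.nontrivial_iff.2 fun h ↦ hreg.2 ?_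
    rw [h, Submodule.top_smul]
  exact le_add_of_nonneg_left ringKrullDim_nonneg_of_nontrivial

/-- A ring `R ⧸ I` that is filtered by factorial rings whose maximal ideals have height two is
Cohen-Macaulay of dimension two. -/
theorem HasPrimeFiltration.isCohenMacaulayRing_quotient {R : Type*} [CommRing R]
    [IsNoetherianRing R] {S : Set (Ideal R)}
    (hfin : S.Finite) (hprime : ∀ P ∈ S, P.IsPrime)
    (hUFD : ∀ P ∈ S, ∀ _ : IsDomain (R ⧸ P), UniqueFactorizationMonoid (R ⧸ P))
    (hht : ∀ P ∈ S, ∀ 𝔫 : Ideal (R ⧸ P), 𝔫.IsMaximal → 𝔫.height = 2)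
    {I : Ideal R} (hI : HasPrimeFiltration S I) : IsCohenMacaulayRing (R ⧸ I) := by
  refine ⟨inferInstance, fun m hm ↦ le_antisymm (localDepth_le_ringKrullDim _) ?_⟩
  have hdim : ringKrullDim (Localization.AtPrime m) ≤ 2 := by
    have h1 : ringKrullDim (Localization.AtPrime m) ≤ ringKrullDim (R ⧸ I) := by
      rw [IsLocalization.AtPrime.ringKrullDim_eq_height m]
      exact Ideal.height_le_ringKrullDim_of_isPrime
    refine h1.trans ?_
    rw [ringKrullDim_quotient]
    refine iSup_le fun p ↦ ?_
    obtain ⟨P, hP, hPle⟩ := hI.exists_le_of_isPrime p.head.1.2 p.head.2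
    have hP2 : ringKrullDim (R ⧸ P) ≤ 2 := by
      rw [ringKrullDim_le_iff_isMaximal_height_le]
      intro 𝔫 h𝔫
      rw [hht P hP 𝔫 h𝔫]
      rfl
    rw [ringKrullDim_quotient] at hP2
    let f : ∀ i, PrimeSpectrum.zeroLocus (R := R) P := fun i ↦
      ⟨(p i).1, hPle.trans (p.monotone (Fin.zero_le i))⟩
    let p' : LTSeries (PrimeSpectrum.zeroLocus (R := R) P) :=
      ⟨p.length, f, fun i ↦ p.step i⟩
    exact (Order.LTSeries.length_le_krullDim p').trans hP2
  refine hdim.trans ?_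
  have hM : (m.comap (Ideal.Quotient.mk I)).IsMaximal :=
    Ideal.comap_isMaximal_of_surjective _ Ideal.Quotient.mk_surjective
  obtain ⟨a, haM, b, hbM, ha, hb⟩ := exists_pair_of_isMaximal hfin hprime hUFD hht hM
  have hreg : IsWeaklyRegular (R ⧸ I) [Ideal.Quotient.mk I a, Ideal.Quotient.mk I b] := by
    rw [isWeaklyRegular_cons_iff, isWeaklyRegular_singleton_iff]
    constructor
    · rw [isSMulRegular_iff_right_eq_zero_of_smul]
      intro x hx
      obtain ⟨x, rfl⟩ := Ideal.Quotient.mk_surjective x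
      rw [smul_eq_mul, ← map_mul, Ideal.Quotient.eq_zero_iff_mem] at hx
      rw [Ideal.Quotient.eq_zero_iff_mem]
      exact hI.mem_of_mul_mem (fun P hP ↦ ⟨hprime P hP, ha P hP⟩) hx
    · refine (isSMulRegular_quotient_iff_mem_of_smul_mem _ _).2 fun x hx ↦ ?_
      obtain ⟨x, rfl⟩ := Ideal.Quotient.mk_surjective x
      have hmem : ∀ y, Ideal.Quotient.mk I y ∈
          (Ideal.Quotient.mk I a) • (⊤ : Submodule (R ⧸ I) (R ⧸ I)) ↔ y ∈ I ⊔ Ideal.span {a} := by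
        intro y
        have : (Ideal.Quotient.mk I a) • (⊤ : Submodule (R ⧸ I) (R ⧸ I)) =
            Ideal.span {Ideal.Quotient.mk I a} := by
          rw [← Submodule.ideal_span_singleton_smul, smul_eq_mul, Ideal.mul_top]
        rw [this, ← Set.image_singleton, ← Ideal.map_span,
          ← Ideal.mem_comap, Ideal.comap_map_of_surjective' _ Ideal.Quotient.mk_surjective,
          Ideal.mk_ker, sup_comm]
      rw [smul_eq_mul, ← map_mul, hmem] at hx
      rw [hmem]
      exact hI.mem_sup_of_mul_mem_sup (fun P hP ↦ ⟨hprime P hP, ha P hP⟩) hb hx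
  have hreg' := hreg.isRegular_of_isLocalization_of_mem (Localization.AtPrime m) m (by
    intro r hr
    simp only [List.mem_cons, List.not_mem_nil, or_false] at hr
    rcases hr with rfl | rfl
    exacts [haM, hbM])
  have hdepth : (2 : ℕ∞) ≤ localDepth (Localization.AtPrime m) := by
    refine le_iSup_of_le ⟨_, ?_, hreg'⟩ (by simp)
    intro r hr
    simp only [List.map_cons, List.map_nil, List.mem_cons, List.not_mem_nil, or_false] at hr
    rcases hr with rfl | rfl <;>
    rw [IsLocalization.AtPrime.to_map_mem_maximal_iff (Localization.AtPrime m) m]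
    exacts [haM, hbM]
  exact WithBot.coe_le_coe.2 hdepth

/-- If no factor of a prime filtration of `R ⧸ I` is annihilated by the variables, then `I` is
saturated. -/
lemma HasPrimeFiltration.saturation_eq {k : Type*} [Field k] {n : ℕ}
    {S : Set (Ideal (MvPolynomial (Fin (n + 1)) k))} {I : Ideal (MvPolynomial (Fin (n + 1)) k)}
    (hI : HasPrimeFiltration S I)
    (hS : ∀ P ∈ S, P.IsPrime ∧ ¬ Ideal.span (Set.range X) ≤ P) : saturation I = I := by
  refine le_antisymm (iSup_le fun e x hx ↦ ?_) ?_
  · rw [Submodule.mem_colon] at hx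
    refine hI.mem_of_forall_mul_mem (𝔞 := Ideal.span (Set.range X) ^ e)
      (fun P hP ↦ ⟨(hS P hP).1, fun h ↦ (hS P hP).2 ((hS P hP).1.le_of_pow_le h)⟩)
      fun a ha ↦ ?_
    rw [mul_comm]
    exact hx a ha
  · refine le_iSup_of_le 0 Ideal.le_colon

end CohenMacaulay

/-! ### Linear coordinates along a line -/

lemma Module.Basis.sumExtend_inl {ι K V : Type*} [DivisionRing K] [AddCommGroup V] [Module K V]
    {v : ι → V} (hs : LinearIndependent K v) (i : ι) :
    Module.Basis.sumExtend hs (Sum.inl i) = v i := by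
  rw [Module.Basis.sumExtend, Module.Basis.reindex_apply, Module.Basis.extend_apply_self]
  classical
  exact congrArg Subtype.val (Equiv.Set.sumDiffSubset_apply_inl
    (hs.linearIndepOn_id.subset_extend (Set.subset_univ _)) (Equiv.ofInjective v hs.injective i))

section LineCoordinates

variable {k : Type*} [Field k]

/-- Every maximal ideal of the polynomial ring in two variables over a field has height two. -/
lemma MvPolynomial.height_eq_two_of_isMaximal (𝔫 : Ideal (MvPolynomial (Fin 2) k))
    (h𝔫 : 𝔫.IsMaximal) : 𝔫.height = 2 := by
  let e := (Polynomial.Bivariate.equivMvPolynomial k).toRingEquiv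
  rw [← RingEquiv.height_comap e 𝔫]
  set P := 𝔫.comap e
  have hP : P.IsMaximal := Ideal.comap_isMaximal_of_equiv e
  have hp : (P.under (Polynomial k)).IsMaximal :=
    Polynomial.isMaximal_comap_C_of_isJacobsonRing P
  rw [Polynomial.height_eq_height_add_one (P.under (Polynomial k)) P,
    IsPrincipalIdealRing.height_eq_one_of_isMaximal _ (Polynomial.not_isField k)]
  rfl

lemma MvPolynomial.ker_constantCoeff_eq_idealOfVars (σ : Type*) :
    RingHom.ker (constantCoeff : MvPolynomial σ k →+* k) = idealOfVars σ k := by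
  ext p
  rw [← pow_one (idealOfVars _ _), mem_pow_idealOfVars_iff', RingHom.mem_ker]
  constructor
  · intro h x hx
    have : x = 0 := by
      rw [← Finsupp.degree_eq_zero_iff]
      omega
    rw [this]
    exact h
  · intro h
    exact h 0 (by simp)

lemma MvPolynomial.ker_constantCoeff_isMaximal (σ : Type*) :
    (RingHom.ker (constantCoeff : MvPolynomial σ k →+* k)).IsMaximal :=
  RingHom.ker_isMaximal_of_surjective _ fun a ↦ ⟨C a, by simp⟩

variable {R : Type*} [CommRing R]
  (φ : MvPolynomial (Fin 2) (MvPolynomial (Fin 2) k) ≃+* R)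

/-- The inclusion of the subring generated by the two transversal coordinates of a line. A line is
given by an isomorphism `φ` of `R` with a polynomial ring in two sets of two variables: the
variables of the coefficient ring are the transversal coordinates, the outer ones are coordinates on
the line. -/
noncomputable def transversalInclusion : MvPolynomial (Fin 2) k →+* R :=
  (φ : MvPolynomial (Fin 2) (MvPolynomial (Fin 2) k) →+* R).comp C

/-- The ideal of the line on which the two transversal coordinates vanish. -/
noncomputable def coordinateLine : Ideal R :=
  Ideal.span {φ (C (X 0)), φ (C (X 1))}

/-- The restriction of functions to the line on which the transversal coordinates vanish. -/
noncomputable def restrictToLine : R →+* MvPolynomial (Fin 2) k :=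
  (MvPolynomial.map constantCoeff).comp
    (φ.symm : R →+* MvPolynomial (Fin 2) (MvPolynomial (Fin 2) k))

lemma map_transversalInclusion_ker :
    (RingHom.ker (constantCoeff : MvPolynomial (Fin 2) k →+* k)).map (transversalInclusion φ) =
      coordinateLine φ := by
  rw [MvPolynomial.ker_constantCoeff_eq_idealOfVars, idealOfVars, Ideal.map_span, coordinateLine,
    ← Set.range_comp]
  congr 1
  ext x
  simp [transversalInclusion, eq_comm]

lemma mem_map_transversalInclusion {𝔠 : Ideal (MvPolynomial (Fin 2) k)} {x : R} :
    x ∈ 𝔠.map (transversalInclusion φ) ↔ ∀ m, (φ.symm x).coeff m ∈ 𝔠 := by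
  rw [transversalInclusion, ← Ideal.map_map, ← MvPolynomial.mem_map_C_iff]
  exact Ideal.mem_map_of_equiv φ x |>.trans
    ⟨fun ⟨y, hy, e⟩ ↦ by rwa [← e, RingEquiv.symm_apply_apply],
      fun h ↦ ⟨_, h, RingEquiv.apply_symm_apply _ _⟩⟩

lemma restrictToLine_surjective : Function.Surjective (restrictToLine φ) := by
  rw [restrictToLine, RingHom.coe_comp]
  refine (MvPolynomial.map_surjective _ fun a ↦ ⟨C a, by simp⟩).comp ?_
  exact φ.symm.surjective

lemma ker_restrictToLine : RingHom.ker (restrictToLine φ) = coordinateLine φ := by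
  ext x
  rw [← map_transversalInclusion_ker, mem_map_transversalInclusion, ← MvPolynomial.mem_map_C_iff,
    ← MvPolynomial.ker_map]
  rfl

/-- The coordinate ring of a line is a polynomial ring. -/
noncomputable def coordinateLineQuotientEquiv :
    R ⧸ coordinateLine φ ≃+* MvPolynomial (Fin 2) k :=
  (Ideal.quotEquivOfEq (ker_restrictToLine φ).symm).trans
    (RingHom.quotientKerEquivOfSurjective (restrictToLine_surjective φ))

lemma coordinateLine_isPrime : (coordinateLine φ).IsPrime := by
  rw [← ker_restrictToLine]
  exact RingHom.ker_isPrime _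

lemma coordinateLine_uniqueFactorizationMonoid (_ : IsDomain (R ⧸ coordinateLine φ)) :
    UniqueFactorizationMonoid (R ⧸ coordinateLine φ) :=
  (coordinateLineQuotientEquiv φ).symm.toMulEquiv.uniqueFactorizationMonoid inferInstance

lemma coordinateLine_quotient_height (𝔫 : Ideal (R ⧸ coordinateLine φ)) (h𝔫 : 𝔫.IsMaximal) :
    𝔫.height = 2 := by
  rw [← RingEquiv.height_comap (coordinateLineQuotientEquiv φ).symm 𝔫]
  exact MvPolynomial.height_eq_two_of_isMaximal _ (Ideal.comap_isMaximal_of_equiv _)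

lemma coordinateLine_not_isMaximal : ¬ (coordinateLine φ).IsMaximal := by
  intro hmax
  have h2 := coordinateLine_quotient_height φ ⊥ (Ideal.bot_quotient_isMaximal_iff _ |>.2 hmax)
  have := coordinateLine_isPrime φ
  rw [Ideal.height_bot] at h2
  simp at h2

lemma transversalCoordinate_prime (i : Fin 2) : Prime (φ (C (X i))) :=
  (MulEquiv.prime_iff φ.toMulEquiv).2 ((MvPolynomial.prime_C_iff _).2 MvPolynomial.X_prime)

lemma transversalCoordinate_isRelPrime : IsRelPrime (φ (C (X 0))) (φ (C (X 1))) := by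
  have := (transversalCoordinate_prime φ 0)
  have hd : IsDomain R := φ.symm.toMulEquiv.isDomain _
  refine this.irreducible.isRelPrime_iff_not_dvd.2 fun h ↦ ?_
  have h1 := map_dvd ((constantCoeff : MvPolynomial (Fin 2) (MvPolynomial (Fin 2) k) →+* _).comp
    (φ.symm : R →+* MvPolynomial (Fin 2) (MvPolynomial (Fin 2) k))) h
  simp at h1

lemma coordinateLine_height [IsNoetherianRing R] : (coordinateLine φ).height = 2 := by
  have hd : IsDomain R := φ.symm.toMulEquiv.isDomain _
  have hprime := coordinateLine_isPrime φ
  apply le_antisymm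
  · have := Ideal.height_le_card_of_mem_minimalPrimes_span (p := coordinateLine φ)
      (s := {φ (C (X 0)), φ (C (X 1))}) (by simp) (by
        have := Ideal.minimalPrimes_eq_subsingleton_self (I := coordinateLine φ)
        rw [← coordinateLine, this]
        rfl)
    refine this.trans ?_
    exact_mod_cast (Set.ncard_insert_le _ _).trans (by rw [Set.ncard_singleton])
  · have h0 := transversalCoordinate_prime φ 0
    have h0' : (Ideal.span {φ (C (X 0))}).IsPrime := (Ideal.span_singleton_prime h0.ne_zero).2 h0
    have h1 : (⊥ : Ideal R) < Ideal.span {φ (C (X 0))} := by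
      rw [bot_lt_iff_ne_bot, Ne, Ideal.span_singleton_eq_bot]
      exact h0.ne_zero
    have h2 : Ideal.span {φ (C (X 0))} < coordinateLine φ := by
      refine lt_of_le_of_ne (Ideal.span_mono (by simp)) fun h ↦ ?_
      have : φ (C (X 1)) ∈ Ideal.span {φ (C (X 0))} := by
        rw [h]; exact Ideal.subset_span (by simp)
      rw [Ideal.mem_span_singleton] at this
      exact h0.not_isUnit ((transversalCoordinate_isRelPrime φ) dvd_rfl this)
    have h3 := Ideal.height_add_one_le_of_lt_of_isPrime h1
    have h4 := Ideal.height_add_one_le_of_lt_of_isPrime h2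
    rw [Ideal.height_bot] at h3
    calc (2 : ℕ∞) = 0 + 1 + 1 := by norm_num
      _ ≤ _ := (add_le_add_left h3 1).trans h4

/-- An ideal generated by polynomials in the transversal coordinates of a line, whose radical
contains the ideal `P` of the line, is filtered by copies of `R ⧸ P`. -/
lemma hasPrimeFiltration_of_transversal [IsNoetherianRing R] {q : Ideal R}
    (hq : ∃ s ⊆ Set.range (transversalInclusion φ), q = Ideal.span s)
    (hrad : coordinateLine φ ≤ q.radical) : HasPrimeFiltration {coordinateLine φ} q := by
  set f := transversalInclusion φ
  obtain ⟨s, hs, rfl⟩ := hq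
  have hmap : Ideal.map f ((Ideal.span s).comap f) = Ideal.span s := by
    refine le_antisymm Ideal.map_comap_le (Ideal.span_le.2 fun x hx ↦ ?_)
    obtain ⟨y, rfl⟩ := hs hx
    exact Ideal.mem_map_of_mem f (Ideal.mem_comap.2 (Ideal.subset_span hx))
  set 𝔪 := RingHom.ker (constantCoeff : MvPolynomial (Fin 2) k →+* k) with h𝔪
  have hle : 𝔪 ≤ ((Ideal.span s).comap f).radical := by
    rw [← Ideal.comap_radical, ← Ideal.map_le_iff_le_comap]
    exact (map_transversalInclusion_ker φ).trans_le hrad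
  obtain ⟨N, hN⟩ := Ideal.exists_pow_le_of_le_radical_of_fg hle (IsNoetherian.noetherian _)
  have hmax : 𝔪.IsMaximal := MvPolynomial.ker_constantCoeff_isMaximal _
  have := HasPrimeFiltration.map_of_pow_le f (fun 𝔠 c x hx ↦ ?_) hmax hN
  · rwa [hmap, h𝔪, map_transversalInclusion_ker] at this
  · rw [Submodule.mem_colon_singleton, smul_eq_mul, mem_map_transversalInclusion] at hx
    rw [mem_map_transversalInclusion]
    intro m
    rw [Submodule.mem_colon_singleton, smul_eq_mul]
    have := hx m
    rw [map_mul] at this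
    simpa [f, transversalInclusion, mul_comm _ (C c), mul_comm _ c] using this

end LineCoordinates

section LinearForms

variable {k : Type*} [Field k] {n : ℕ}

/-- The linear form with a given coefficient vector. -/
noncomputable def linearForm : (Fin n → k) →ₗ[k] MvPolynomial (Fin n) k :=
  Fintype.linearCombination k X

lemma exists_linearForm_eq {f : MvPolynomial (Fin n) k} (hf : f.IsHomogeneous 1) :
    ∃ v, linearForm v = f := by
  rw [← mem_homogeneousSubmodule, homogeneousSubmodule_one_eq_span_X,
    Submodule.mem_span_range_iff_exists_fun] at hf
  obtain ⟨c, hc⟩ := hf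
  exact ⟨c, by rw [← hc, linearForm, Fintype.linearCombination_apply]⟩

lemma linearForm_isHomogeneous (v : Fin n → k) : (linearForm v).IsHomogeneous 1 := by
  rw [← mem_homogeneousSubmodule, homogeneousSubmodule_one_eq_span_X,
    Submodule.mem_span_range_iff_exists_fun]
  exact ⟨v, by rw [linearForm, Fintype.linearCombination_apply]⟩

@[simp]
lemma pderiv_linearForm (v : Fin n → k) (j : Fin n) : pderiv j (linearForm v) = C (v j) := by
  simp [linearForm, Fintype.linearCombination_apply, pderiv_X, Pi.single_apply,
    smul_eq_C_mul]

@[simp]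
lemma constantCoeff_linearForm (v : Fin n → k) : constantCoeff (linearForm v) = 0 := by
  simp [linearForm, Fintype.linearCombination_apply, smul_eq_C_mul]

/-- A linear form in the ideal generated by two linear forms is a linear combination of them. -/
lemma exists_linearForm_eq_of_mem_span {u v w : Fin n → k}
    (h : linearForm u ∈ Ideal.span {linearForm v, linearForm w}) :
    ∃ a b : k, u = a • v + b • w := by
  obtain ⟨x, y, e⟩ := Ideal.mem_span_pair.1 h
  -- Compare the coefficients of the linear terms.
  refine ⟨constantCoeff x, constantCoeff y, funext fun j ↦ ?_⟩
  have := congr_arg (fun p ↦ constantCoeff (pderiv j p)) e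
  simp at this
  simp [← this]

/-- Two linearly independent linear forms in four variables are part of a system of linear
coordinates. -/
lemma exists_coordinates {v w : Fin 4 → k} (h : LinearIndependent k ![v, w]) :
    ∃ φ : MvPolynomial (Fin 2) (MvPolynomial (Fin 2) k) ≃ₐ[k] MvPolynomial (Fin 4) k,
      φ (C (X 0)) = linearForm v ∧ φ (C (X 1)) = linearForm w := by
  let b := Module.Basis.sumExtend h
  have hfin : Finite (Fin 2 ⊕ Module.Basis.sumExtendIndex h) := Module.Finite.finite_basis b
  have : Finite (Module.Basis.sumExtendIndex h) := Finite.sum_right (Fin 2)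
  have hcard : Nat.card (Module.Basis.sumExtendIndex h) = 2 := by
    have h1 := Module.finrank_eq_nat_card_basis b
    rw [Nat.card_sum, Module.finrank_fin_fun, Nat.card_fin] at h1
    omega
  let b' : Module.Basis (Fin 2 ⊕ Fin 2) k (Fin 4 → k) :=
    b.reindex ((Equiv.sumCongr (Equiv.refl _) (Finite.equivFinOfCardEq hcard)).trans
      (Equiv.sumComm _ _))
  have hb' : ∀ i : Fin 2, b' (Sum.inr i) = ![v, w] i := by
    intro i
    simp only [b', b, Module.Basis.reindex_apply, Equiv.symm_trans_apply, Equiv.sumComm_symm,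
      Equiv.sumComm_apply, Sum.swap_inr, Equiv.sumCongr_symm, Equiv.sumCongr_apply, Sum.map_inl,
      Equiv.refl_symm, Equiv.refl_apply]
    exact Module.Basis.sumExtend_inl h i
  let e := SymmetricAlgebra.equivMvPolynomial (Pi.basisFun k (Fin 4))
  have he : ∀ u, e (SymmetricAlgebra.ι k _ u) = linearForm u := by
    intro u
    have : (e.toLinearMap.comp (SymmetricAlgebra.ι k (Fin 4 → k))) = linearForm := by
      refine (Pi.basisFun k (Fin 4)).ext fun i ↦ ?_
      simp only [LinearMap.comp_apply, AlgEquiv.toLinearMap_apply, e,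
        SymmetricAlgebra.equivMvPolynomial_ι_apply]
      simp [linearForm, Fintype.linearCombination_apply, Pi.single_apply]
    exact LinearMap.congr_fun this u
  let φ := ((sumAlgEquiv k (Fin 2) (Fin 2)).symm.trans
    (SymmetricAlgebra.equivMvPolynomial b').symm).trans e
  have hφ : ∀ i : Fin 2, φ (C (X i)) = linearForm (![v, w] i) := by
    intro i
    simp only [φ, AlgEquiv.trans_apply, sumAlgEquiv_symm_C_X,
      SymmetricAlgebra.equivMvPolynomial_symm_X, he, hb']
  exact ⟨φ, hφ 0, hφ 1⟩

end LinearForms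

/-! ### Jacobian ideals of arrangements -/

section Jacobian

variable {k : Type*} [Field k] {n : ℕ} {ι : Type*}

lemma pderiv_mem_pow {Q : Ideal (MvPolynomial (Fin n) k)} (j : Fin n) (m : ℕ) :
    ∀ x ∈ Q ^ (m + 1), pderiv j x ∈ Q ^ m := by
  induction m with
  | zero => simp
  | succ m ih =>
    intro x hx
    rw [pow_succ'] at hx
    refine Submodule.mul_induction_on hx (fun a ha b hb ↦ ?_) fun a b ha hb ↦ ?_
    · rw [pderiv_mul]
      refine Ideal.add_mem _ (Ideal.mul_mem_left _ _ hb) ?_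
      rw [pow_succ']
      exact Ideal.mul_mem_mul ha (ih b hb)
    · rw [map_add]
      exact Ideal.add_mem _ ha hb

lemma jacobianIdeal_le_pow {Q : Ideal (MvPolynomial (Fin (n + 1)) k)} {m : ℕ}
    {F : MvPolynomial (Fin (n + 1)) k} (hF : F ∈ Q ^ (m + 1)) : jacobianIdeal F ≤ Q ^ m := by
  refine Ideal.span_le.2 ?_
  rintro _ ⟨j, rfl⟩
  exact pderiv_mem_pow j m F hF

lemma pderiv_mem_jacobianIdeal (F : MvPolynomial (Fin (n + 1)) k) (j : Fin (n + 1)) :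
    pderiv j F ∈ jacobianIdeal F :=
  Ideal.subset_span ⟨j, rfl⟩

/-- By Euler's identity, a form of positive degree lies in its Jacobian ideal in characteristic
zero. -/
lemma mem_jacobianIdeal_of_isHomogeneous [CharZero k] {F : MvPolynomial (Fin (n + 1)) k} {m : ℕ}
    (hF : F.IsHomogeneous m) (hm : m ≠ 0) : F ∈ jacobianIdeal F := by
  have h : m • F ∈ jacobianIdeal F := by
    rw [← hF.sum_X_mul_pderiv]
    exact Ideal.sum_mem _ fun j _ ↦ Ideal.mul_mem_left _ _ (pderiv_mem_jacobianIdeal F j)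
  have h' := Ideal.mul_mem_left _ (C ((m : k)⁻¹)) h
  rwa [nsmul_eq_mul, ← mul_assoc, ← map_natCast (C : k →+* MvPolynomial (Fin (n + 1)) k),
    ← C_mul, inv_mul_cancel₀ (Nat.cast_ne_zero.2 hm), C_1, one_mul] at h'

variable (v : ι → Fin (n + 1) → k)

lemma prod_linearForm_mem_jacobianIdeal [CharZero k] {s : Finset ι} (hs : s.Nonempty) :
    ∏ i ∈ s, linearForm (v i) ∈ jacobianIdeal (∏ i ∈ s, linearForm (v i)) :=
  mem_jacobianIdeal_of_isHomogeneous
    (IsHomogeneous.prod s _ (fun _ ↦ 1) fun i _ ↦ linearForm_isHomogeneous (v i))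
    (by simpa using hs.ne_empty)

lemma exists_pderiv_linearForm_notMem {v : Fin n → k} (hv : v ≠ 0)
    {Q : Ideal (MvPolynomial (Fin n) k)} (hQ : Q ≠ ⊤) : ∃ j, pderiv j (linearForm v) ∉ Q := by
  obtain ⟨j, hj⟩ := Function.ne_iff.1 hv
  refine ⟨j, fun h ↦ hQ (Ideal.eq_top_of_isUnit_mem _ h ?_)⟩
  rw [pderiv_linearForm]
  exact (isUnit_iff_ne_zero.2 hj).map C

lemma linearForm_ne_zero {v : Fin n → k} (hv : v ≠ 0) : linearForm v ≠ 0 := by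
  obtain ⟨j, hj⟩ := exists_pderiv_linearForm_notMem hv (Q := ⊥) bot_ne_top
  intro h
  exact hj (by rw [h, map_zero]; exact zero_mem _)

/-- The singular locus of an arrangement is the union of the pairwise intersections. -/
lemma exists_ne_linearForm_mem_of_jacobianIdeal_le [CharZero k] (hv : ∀ i, v i ≠ 0)
    {s : Finset ι} (hs : s.Nonempty) {Q : Ideal (MvPolynomial (Fin (n + 1)) k)} (hQ : Q.IsPrime)
    (h : jacobianIdeal (∏ i ∈ s, linearForm (v i)) ≤ Q) :
    ∃ a ∈ s, ∃ b ∈ s, a ≠ b ∧ linearForm (v a) ∈ Q ∧ linearForm (v b) ∈ Q := by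
  classical
  obtain ⟨a, ha, haQ⟩ := (hQ.prod_mem_iff).1 (h (prod_linearForm_mem_jacobianIdeal v hs))
  obtain ⟨j, hj⟩ := exists_pderiv_linearForm_notMem (hv a) hQ.ne_top
  have h1 := h (pderiv_mem_jacobianIdeal _ j)
  rw [← Finset.mul_prod_erase s _ ha, pderiv_mul] at h1
  have h2 := (Ideal.add_mem_iff_left _ (Ideal.mul_mem_right _ _ haQ)).1 h1
  obtain ⟨b, hb, hbQ⟩ := (hQ.prod_mem_iff).1 ((hQ.mem_or_mem h2).resolve_left hj)
  exact ⟨a, ha, b, Finset.mem_of_mem_erase hb, (Finset.ne_of_mem_erase hb).symm, haQ, hbQ⟩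

lemma prod_linearForm_mem_pow_card {Q : Ideal (MvPolynomial (Fin (n + 1)) k)} {s t : Finset ι}
    (hts : t ⊆ s) (ht : ∀ i ∈ t, linearForm (v i) ∈ Q) :
    ∏ i ∈ s, linearForm (v i) ∈ Q ^ t.card := by
  refine Ideal.mem_of_dvd _ (Finset.prod_dvd_prod_of_subset t s _ hts) ?_
  rw [← Finset.prod_const]
  exact Ideal.prod_mem_prod ht

/-- Where `H` is invertible, the Jacobian ideals of `G` and `G * H` agree; this is the inclusion
that holds everywhere. -/
lemma jacobianIdeal_mul_le_left {G H : MvPolynomial (Fin (n + 1)) k} (hG : G ∈ jacobianIdeal G) :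
    jacobianIdeal (G * H) ≤ jacobianIdeal G := by
  refine Ideal.span_le.2 ?_
  rintro _ ⟨j, rfl⟩
  simp only [pderiv_mul]
  exact Ideal.add_mem _ (Ideal.mul_mem_right _ _ (pderiv_mem_jacobianIdeal G j))
    (Ideal.mul_mem_right _ _ hG)

/-- Where `H` is invertible, the Jacobian ideal of `G` is contained in that of `G * H`. -/
lemma sq_mul_pderiv_mem_jacobianIdeal {G H : MvPolynomial (Fin (n + 1)) k}
    (hF : G * H ∈ jacobianIdeal (G * H)) (j : Fin (n + 1)) :
    H ^ 2 * pderiv j G ∈ jacobianIdeal (G * H) := by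
  have h1 := Ideal.mul_mem_left _ H (pderiv_mem_jacobianIdeal (G * H) j)
  have h2 := Ideal.mul_mem_left _ (pderiv j H) hF
  have h3 := Ideal.sub_mem _ h1 h2
  rw [pderiv_mul] at h3
  convert h3 using 1
  ring

lemma pderiv_prod_linearForm_mem_subalgebra (s : Finset ι)
    {A : Subalgebra k (MvPolynomial (Fin (n + 1)) k)} (hA : ∀ i ∈ s, linearForm (v i) ∈ A)
    (j : Fin (n + 1)) : pderiv j (∏ i ∈ s, linearForm (v i)) ∈ A := by
  classical
  induction s using Finset.induction_on with
  | empty => simp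
  | insert a s ha ih =>
    rw [Finset.prod_insert ha, pderiv_mul, pderiv_linearForm]
    have hA' : ∀ i ∈ s, linearForm (v i) ∈ A := fun i hi ↦ hA i (Finset.mem_insert_of_mem hi)
    exact A.add_mem (A.mul_mem (A.algebraMap_mem _) (A.prod_mem hA'))
      (A.mul_mem (hA a (Finset.mem_insert_self a s)) (ih hA'))

/-- A node is reduced: the Jacobian ideal of the product of two independent linear forms contains
both of them. -/
lemma span_pair_le_jacobianIdeal_mul {u w : Fin (n + 1) → k}
    (h : LinearIndependent k ![u, w]) :
    Ideal.span {linearForm u, linearForm w} ≤ jacobianIdeal (linearForm u * linearForm w) := by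
  -- Differentiate in a direction in which exactly one of the two forms is constant.
  have key : ∀ i : Fin 2, ∃ f : (Fin (n + 1) → k) →ₗ[k] k,
      ∀ j, f (![u, w] j) = if i = j then 1 else 0 := by
    intro i
    refine ⟨(Module.Basis.sumExtend h).coord (Sum.inl i), fun j ↦ ?_⟩
    rw [← Module.Basis.sumExtend_inl h j, Module.Basis.coord_apply, Module.Basis.repr_self]
    by_cases hij : i = j
    · subst hij
      simp
    · rw [if_neg hij, Finsupp.single_eq_of_ne]
      exact fun h ↦ hij (Sum.inl_injective h)
  have hD : ∀ f : (Fin (n + 1) → k) →ₗ[k] k,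
      C (f u) * linearForm w + C (f w) * linearForm u ∈
        jacobianIdeal (linearForm u * linearForm w) := by
    intro f
    have : C (f u) * linearForm w + C (f w) * linearForm u =
        ∑ j, C (f (Pi.single j 1)) * pderiv j (linearForm u * linearForm w) := by
      rw [LinearMap.pi_apply_eq_sum_univ f u, LinearMap.pi_apply_eq_sum_univ f w, map_sum,
        map_sum, Finset.sum_mul, Finset.sum_mul, ← Finset.sum_add_distrib]
      refine Finset.sum_congr rfl fun j _ ↦ ?_
      rw [pderiv_mul, pderiv_linearForm, pderiv_linearForm]
      have hsingle : (fun i ↦ if j = i then (1 : k) else 0) = Pi.single j 1 := by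
        ext i
        simp [Pi.single_apply, eq_comm]
      rw [hsingle]
      simp only [smul_eq_mul, C_mul]
      ring
    rw [this]
    exact Ideal.sum_mem _ fun j _ ↦ Ideal.mul_mem_left _ _ (pderiv_mem_jacobianIdeal _ j)
  refine Ideal.span_le.2 ?_
  rintro _ (rfl | rfl)
  · obtain ⟨f, hf⟩ := key 1
    have h0 := hf 0
    have h1 := hf 1
    simp at h0 h1
    simpa [h0, h1] using hD f
  · obtain ⟨f, hf⟩ := key 0
    have h0 := hf 0
    have h1 := hf 1
    simp at h0 h1
    simpa [h0, h1] using hD f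

end Jacobian

section Lines

variable {k : Type*} [Field k] {ι : Type*} (v : ι → Fin (3 + 1) → k)

/-- The ideal of the intersection of two planes of an arrangement. -/
noncomputable def lineIdeal (a b : ι) : Ideal (MvPolynomial (Fin (3 + 1)) k) :=
  Ideal.span {linearForm (v a), linearForm (v b)}

/-- The planes of an arrangement that contain the subvariety with ideal `P`. -/
noncomputable def planesThrough [Fintype ι] (P : Ideal (MvPolynomial (Fin (3 + 1)) k)) :
    Finset ι :=
  open scoped Classical in Finset.univ.filter fun i ↦ linearForm (v i) ∈ P

/-- The ideal of the scheme structure along a line with ideal `P`: the Jacobian ideal of the product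
of the planes through the line. -/
noncomputable def lineComponent [Fintype ι] (P : Ideal (MvPolynomial (Fin (3 + 1)) k)) :
    Ideal (MvPolynomial (Fin (3 + 1)) k) :=
  jacobianIdeal (∏ i ∈ planesThrough v P, linearForm (v i))

variable {v}

@[simp]
lemma mem_planesThrough [Fintype ι] {P : Ideal (MvPolynomial (Fin (3 + 1)) k)} {i : ι} :
    i ∈ planesThrough v P ↔ linearForm (v i) ∈ P := by
  simp [planesThrough]

lemma left_mem_lineIdeal (a b : ι) : linearForm (v a) ∈ lineIdeal v a b :=
  Ideal.subset_span (by simp)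

lemma right_mem_lineIdeal (a b : ι) : linearForm (v b) ∈ lineIdeal v a b :=
  Ideal.subset_span (by simp)

lemma lineIdeal_comm (a b : ι) : lineIdeal v a b = lineIdeal v b a := by
  rw [lineIdeal, lineIdeal, Set.pair_comm]

lemma lineIdeal_le {a b : ι} {Q : Ideal (MvPolynomial (Fin (3 + 1)) k)}
    (ha : linearForm (v a) ∈ Q) (hb : linearForm (v b) ∈ Q) : lineIdeal v a b ≤ Q := by
  refine Ideal.span_le.2 ?_
  rintro _ (rfl | rfl)
  exacts [ha, hb]

lemma planesThrough_nonempty [Fintype ι] (a b : ι) :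
    (planesThrough v (lineIdeal v a b)).Nonempty :=
  ⟨a, mem_planesThrough.2 (left_mem_lineIdeal a b)⟩

lemma exists_coordinates_lineIdeal (hv : Pairwise fun i j ↦ LinearIndependent k ![v i, v j])
    {a b : ι} (hab : a ≠ b) :
    ∃ φ : MvPolynomial (Fin 2) (MvPolynomial (Fin 2) k) ≃ₐ[k] MvPolynomial (Fin (3 + 1)) k,
      φ (C (X 0)) = linearForm (v a) ∧ φ (C (X 1)) = linearForm (v b) ∧
      lineIdeal v a b = coordinateLine
        (φ : MvPolynomial (Fin 2) (MvPolynomial (Fin 2) k) ≃+* _) := by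
  obtain ⟨φ, h0, h1⟩ := exists_coordinates (hv hab)
  refine ⟨φ, h0, h1, ?_⟩
  rw [lineIdeal, ← h0, ← h1]
  rfl

lemma lineIdeal_isPrime (hv : Pairwise fun i j ↦ LinearIndependent k ![v i, v j])
    {a b : ι} (hab : a ≠ b) : (lineIdeal v a b).IsPrime := by
  obtain ⟨φ, -, -, h⟩ := exists_coordinates_lineIdeal hv hab
  exact h ▸ coordinateLine_isPrime _

lemma lineIdeal_height (hv : Pairwise fun i j ↦ LinearIndependent k ![v i, v j])
    {a b : ι} (hab : a ≠ b) : (lineIdeal v a b).height = 2 := by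
  obtain ⟨φ, -, -, h⟩ := exists_coordinates_lineIdeal hv hab
  exact h ▸ coordinateLine_height _

lemma lineIdeal_not_isMaximal (hv : Pairwise fun i j ↦ LinearIndependent k ![v i, v j])
    {a b : ι} (hab : a ≠ b) : ¬ (lineIdeal v a b).IsMaximal := by
  obtain ⟨φ, -, -, h⟩ := exists_coordinates_lineIdeal hv hab
  exact h ▸ coordinateLine_not_isMaximal _

lemma linearForm_isRelPrime (hv : Pairwise fun i j ↦ LinearIndependent k ![v i, v j])
    {a b : ι} (hab : a ≠ b) : IsRelPrime (linearForm (v a)) (linearForm (v b)) := by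
  obtain ⟨φ, h0, h1, -⟩ := exists_coordinates_lineIdeal hv hab
  rw [← h0, ← h1]
  exact transversalCoordinate_isRelPrime
    (φ : MvPolynomial (Fin 2) (MvPolynomial (Fin 2) k) ≃+* MvPolynomial (Fin (3 + 1)) k)

/-- All lines have height two, so there are no strict inclusions between them and primes of height
at most two. -/
lemma eq_lineIdeal_of_le_of_height (hv : Pairwise fun i j ↦ LinearIndependent k ![v i, v j])
    {a b : ι} (hab : a ≠ b)
    {Q : Ideal (MvPolynomial (Fin (3 + 1)) k)} (hQ : Q.IsPrime)
    (hht : Q.height ≤ 2) (h : lineIdeal v a b ≤ Q) : lineIdeal v a b = Q := by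
  by_contra hne
  have := lineIdeal_isPrime hv hab
  have h1 := Ideal.height_strict_mono_of_isPrime_of_isPrime (lt_of_le_of_ne h hne)
  rw [lineIdeal_height hv hab] at h1
  exact absurd (h1.trans_le hht) (lt_irrefl _)

/-- A line is determined by any two planes that contain it. -/
lemma lineIdeal_eq (hv : Pairwise fun i j ↦ LinearIndependent k ![v i, v j])
    {a b : ι} (hab : a ≠ b)
    {c e : ι} (hce : c ≠ e) (hc : linearForm (v c) ∈ lineIdeal v a b)
    (he : linearForm (v e) ∈ lineIdeal v a b) : lineIdeal v c e = lineIdeal v a b :=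
  eq_lineIdeal_of_le_of_height hv hce (lineIdeal_isPrime hv hab) (lineIdeal_height hv hab).le
    (lineIdeal_le hc he)

variable [Fintype ι]

lemma lineComponent_le {a b : ι} (hab : a ≠ b) :
    lineComponent v (lineIdeal v a b) ≤ lineIdeal v a b := by
  classical
  have h := prod_linearForm_mem_pow_card v (Q := lineIdeal v a b) (t := {a, b})
    (s := planesThrough v (lineIdeal v a b))
    (by
      intro i hi
      rcases Finset.mem_insert.1 hi with rfl | hi
      · exact mem_planesThrough.2 (left_mem_lineIdeal _ _)
      · rw [Finset.mem_singleton.1 hi]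
        exact mem_planesThrough.2 (right_mem_lineIdeal _ _))
    (by simp [left_mem_lineIdeal, right_mem_lineIdeal])
  rw [Finset.card_pair hab] at h
  simpa [lineComponent] using jacobianIdeal_le_pow h

lemma lineComponent_eq_of_simple (hv : Pairwise fun i j ↦ LinearIndependent k ![v i, v j])
    {a b : ι} (hab : a ≠ b)
    (h : ∀ c, linearForm (v c) ∈ lineIdeal v a b → c = a ∨ c = b) :
    lineComponent v (lineIdeal v a b) = lineIdeal v a b := by
  classical
  have hV : planesThrough v (lineIdeal v a b) = {a, b} := by
    ext c
    rw [mem_planesThrough, Finset.mem_insert, Finset.mem_singleton]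
    refine ⟨h c, ?_⟩
    rintro (rfl | rfl)
    exacts [left_mem_lineIdeal _ _, right_mem_lineIdeal _ _]
  refine le_antisymm (lineComponent_le hab) ?_
  rw [lineComponent, hV, Finset.prod_pair hab]
  exact span_pair_le_jacobianIdeal_mul (hv hab)

/-- The component along a line in three or more planes lies in the square of the ideal of the line,
but no plane does. -/
lemma lineComponent_not_isRadical (hv : Pairwise fun i j ↦ LinearIndependent k ![v i, v j])
    {a b : ι} (hab : a ≠ b)
    (hv0 : ∀ i, v i ≠ 0) {c : ι} (hca : c ≠ a) (hcb : c ≠ b)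
    (hc : linearForm (v c) ∈ lineIdeal v a b)
    (hrad : lineIdeal v a b ≤ (lineComponent v (lineIdeal v a b)).radical) :
    ¬ (lineComponent v (lineIdeal v a b)).IsRadical := by
  classical
  intro h
  have hsq : lineComponent v (lineIdeal v a b) ≤ lineIdeal v a b ^ 2 := by
    have h := prod_linearForm_mem_pow_card v (Q := lineIdeal v a b) (t := {c, a, b})
      (s := planesThrough v (lineIdeal v a b))
      (by
        intro i hi
        simp only [Finset.mem_insert, Finset.mem_singleton] at hi
        rcases hi with rfl | rfl | rfl
        · exact mem_planesThrough.2 hc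
        · exact mem_planesThrough.2 (left_mem_lineIdeal _ _)
        · exact mem_planesThrough.2 (right_mem_lineIdeal _ _))
      (by simp [left_mem_lineIdeal, right_mem_lineIdeal, hc])
    rw [Finset.card_insert_of_notMem (by simp [hca, hcb]), Finset.card_pair hab] at h
    exact jacobianIdeal_le_pow h
  have hmem : linearForm (v a) ∈ lineIdeal v a b ^ 2 :=
    hsq (h.radical ▸ hrad (left_mem_lineIdeal a b))
  obtain ⟨j, hj⟩ := exists_pderiv_linearForm_notMem (hv0 a) (lineIdeal_isPrime hv hab).ne_top
  exact hj (by simpa using pderiv_mem_pow j 1 _ hmem)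

variable [CharZero k]

lemma prod_mem_lineComponent (a b : ι) :
    ∏ i ∈ planesThrough v (lineIdeal v a b), linearForm (v i) ∈
      lineComponent v (lineIdeal v a b) :=
  prod_linearForm_mem_jacobianIdeal v (planesThrough_nonempty a b)

/-- The union of the planes through a line is singular exactly along that line, because any two of
the planes meet in it. -/
lemma lineIdeal_le_radical_lineComponent (hv : Pairwise fun i j ↦ LinearIndependent k ![v i, v j])
    {a b : ι} (hab : a ≠ b)
    (hv0 : ∀ i, v i ≠ 0) :
    lineIdeal v a b ≤ (lineComponent v (lineIdeal v a b)).radical := by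
  rw [Ideal.radical_eq_sInf]
  refine le_sInf fun Q ⟨hle, hQ⟩ ↦ ?_
  obtain ⟨c, hc, e, he, hce, hcQ, heQ⟩ := exists_ne_linearForm_mem_of_jacobianIdeal_le v hv0
    (planesThrough_nonempty a b) hQ hle
  rw [← lineIdeal_eq hv hab hce (mem_planesThrough.1 hc) (mem_planesThrough.1 he)]
  exact lineIdeal_le hcQ heQ

lemma hasPrimeFiltration_lineComponent (hv : Pairwise fun i j ↦ LinearIndependent k ![v i, v j])
    {a b : ι} (hab : a ≠ b)
    (hv0 : ∀ i, v i ≠ 0) :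
    HasPrimeFiltration {lineIdeal v a b} (lineComponent v (lineIdeal v a b)) := by
  have hrad := lineIdeal_le_radical_lineComponent hv hab hv0
  obtain ⟨φ, h0, h1, h⟩ := exists_coordinates_lineIdeal hv hab
  let A : Subalgebra k (MvPolynomial (Fin (3 + 1)) k) :=
    ((φ : MvPolynomial (Fin 2) (MvPolynomial (Fin 2) k) →ₐ[k] MvPolynomial (Fin (3 + 1)) k).comp
      (IsScalarTower.toAlgHom k (MvPolynomial (Fin 2) k)
        (MvPolynomial (Fin 2) (MvPolynomial (Fin 2) k)))).range
  have ha : linearForm (v a) ∈ A := ⟨X 0, h0⟩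
  have hb : linearForm (v b) ∈ A := ⟨X 1, h1⟩
  have hA : ∀ i ∈ planesThrough v (lineIdeal v a b), linearForm (v i) ∈ A := by
    intro i hi
    obtain ⟨x, y, e⟩ := exists_linearForm_eq_of_mem_span (mem_planesThrough.1 hi)
    rw [e, map_add, map_smul, map_smul]
    exact A.add_mem (A.smul_mem ha x) (A.smul_mem hb y)
  have := hasPrimeFiltration_of_transversal
    (φ : MvPolynomial (Fin 2) (MvPolynomial (Fin 2) k) ≃+* MvPolynomial (Fin (3 + 1)) k)
    (q := lineComponent v (lineIdeal v a b)) ⟨_, ?_, rfl⟩ (h ▸ hrad)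
  · rwa [← h] at this
  · rintro _ ⟨j, rfl⟩
    obtain ⟨p, hp⟩ := pderiv_prod_linearForm_mem_subalgebra v _ hA j
    exact ⟨p, hp⟩

end Lines

/-! ### Subarrangements whose planes contain at most one multiple line -/

section PrimaryDecomposition

/-- The second uniqueness theorem for an isolated component `q` of a primary decomposition, in
elementwise form. -/
lemma mem_iff_of_isMinimalPrimaryDecomposition {R : Type*} [CommRing R] {J : Ideal R}
    {t : Finset (Ideal R)} (ht : Submodule.IsMinimalPrimaryDecomposition J t) {q : Ideal R}
    (hq : q ∈ t) (hmin : q.radical ∈ J.minimalPrimes) {x : R} :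
    x ∈ q ↔ ∃ s ∉ q.radical, s * x ∈ J := by
  classical
  have hprim : q.IsPrimary := ht.primary hq
  have hprime : q.radical.IsPrime := hmin.1.1
  have hJle : ∀ q' ∈ t, J ≤ q' := fun q' hq' ↦ ht.inf_eq.symm.trans_le (Finset.inf_le hq')
  constructor
  · intro hx
    -- The other components are not contained in the minimal prime `√q`.
    have hex : ∀ q' ∈ t.erase q, ∃ s ∈ q', s ∉ q.radical := by
      intro q' hq'
      have hq't := Finset.mem_of_mem_erase hq'
      by_contra! hcon
      have hle : q'.radical ≤ q.radical := hprime.radical_le_iff.2 hcon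
      have hge : q.radical ≤ q'.radical :=
        hmin.2 ⟨Ideal.isPrime_radical (ht.primary hq't), (hJle q' hq't).trans Ideal.le_radical⟩ hle
      have := ht.distinct hq't hq (Finset.ne_of_mem_erase hq')
      simp only [Function.onFun, Submodule.colon_univ] at this
      exact this (le_antisymm hle hge)
    choose! s hs hs' using hex
    refine ⟨∏ q' ∈ t.erase q, s q', fun h ↦ ?_, ?_⟩
    · obtain ⟨q', hq', h'⟩ := hprime.prod_mem_iff.1 h
      exact hs' q' hq' h'
    · rw [← ht.inf_eq, Submodule.mem_finsetInf]
      intro q' hq'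
      by_cases h : q' = q
      · subst h
        exact Ideal.mul_mem_left _ _ hx
      · have hmem := Finset.mem_erase.2 ⟨h, hq'⟩
        exact Ideal.mul_mem_right _ _
          (Ideal.mem_of_dvd _ (Finset.dvd_prod_of_mem s hmem) (hs q' hmem))
  · rintro ⟨s, hs, hsx⟩
    rw [mul_comm] at hsx
    exact ((Ideal.isPrimary_iff.1 hprim).2 (hJle q hq hsx)).resolve_right hs

end PrimaryDecomposition

section Arrangement

variable {k : Type*} [Field k] {ι : Type*} {v : ι → Fin (3 + 1) → k}

lemma lineIdeal_uniqueFactorizationMonoid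
    (hv : Pairwise fun i j ↦ LinearIndependent k ![v i, v j]) {a b : ι} (hab : a ≠ b)
    (h : IsDomain (MvPolynomial (Fin (3 + 1)) k ⧸ lineIdeal v a b)) :
    UniqueFactorizationMonoid (MvPolynomial (Fin (3 + 1)) k ⧸ lineIdeal v a b) := by
  obtain ⟨φ, -, -, e⟩ := exists_coordinates_lineIdeal hv hab
  revert h
  rw [e]
  exact coordinateLine_uniqueFactorizationMonoid _

lemma lineIdeal_quotient_height
    (hv : Pairwise fun i j ↦ LinearIndependent k ![v i, v j]) {a b : ι} (hab : a ≠ b)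
    (𝔫 : Ideal (MvPolynomial (Fin (3 + 1)) k ⧸ lineIdeal v a b)) (h𝔫 : 𝔫.IsMaximal) :
    𝔫.height = 2 := by
  obtain ⟨φ, -, -, e⟩ := exists_coordinates_lineIdeal hv hab
  revert 𝔫
  rw [e]
  exact coordinateLine_quotient_height _

variable (v) in
/-- The line in which two planes of an arrangement meet lies on a third plane. -/
def IsMultipleLine (a b : ι) : Prop :=
  ∃ c, c ≠ a ∧ c ≠ b ∧ linearForm (v c) ∈ lineIdeal v a b

/-- The lines in which two planes of `U` meet. -/
def singularLines (v : ι → Fin (3 + 1) → k) (U : Finset ι) :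
    Set (Ideal (MvPolynomial (Fin (3 + 1)) k)) :=
  {P | ∃ a ∈ U, ∃ b ∈ U, a ≠ b ∧ P = lineIdeal v a b}

lemma singularLines_mono {U V : Finset ι} (h : U ⊆ V) : singularLines v U ⊆ singularLines v V :=
  fun _ ⟨a, ha, b, hb, hab, e⟩ ↦ ⟨a, h ha, b, h hb, hab, e⟩

variable [Fintype ι]

/-- The planes of each multiple line either all belong to the subarrangement `U` or all do not. -/
def IsSaturated (v : ι → Fin (3 + 1) → k) (U : Finset ι) : Prop :=
  ∀ a b c, a ≠ b → c ≠ a → c ≠ b → linearForm (v c) ∈ lineIdeal v a b → a ∈ U → b ∈ U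

/-- The ideal of the one-dimensional part of the singular scheme of the subarrangement `U`. -/
noncomputable def singularIdeal (v : ι → Fin (3 + 1) → k) (U : Finset ι) :
    Ideal (MvPolynomial (Fin (3 + 1)) k) :=
  ⨅ a ∈ U, ⨅ b ∈ U, ⨅ _ : a ≠ b, lineComponent v (lineIdeal v a b)

lemma mem_singularIdeal {U : Finset ι} {x : MvPolynomial (Fin (3 + 1)) k} :
    x ∈ singularIdeal v U ↔
      ∀ a ∈ U, ∀ b ∈ U, a ≠ b → x ∈ lineComponent v (lineIdeal v a b) := by
  simp [singularIdeal, Submodule.mem_iInf]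

lemma prod_mem_singularIdeal [CharZero k]
    (hv : Pairwise fun i j ↦ LinearIndependent k ![v i, v j]) {U : Finset ι}
    (hsat : IsSaturated v U) :
    ∏ i ∈ U, linearForm (v i) ∈ singularIdeal v U := by
  rw [mem_singularIdeal]
  intro a ha b hb hab
  refine Ideal.mem_of_dvd _ (Finset.prod_dvd_prod_of_subset _ _ _ fun c hc ↦ ?_)
    (prod_mem_lineComponent a b)
  rw [mem_planesThrough] at hc
  by_cases hca : c = a
  · exact hca ▸ ha
  by_cases hcb : c = b
  · exact hcb ▸ hb
  · have := lineIdeal_eq hv hab (Ne.symm hca) (left_mem_lineIdeal a b) hc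
    exact hsat a c b (Ne.symm hca) hab.symm (Ne.symm hcb) (this ▸ right_mem_lineIdeal a b) ha

/-- Adding to a subarrangement `U` a set `V` of planes which are either a single plane or the planes
through a multiple line, when all lines in which a plane of `U` meets one of `V` are simple. -/
lemma hasPrimeFiltration_singularIdeal_union [DecidableEq ι]
    (hv : Pairwise fun i j ↦ LinearIndependent k ![v i, v j]) (hv0 : ∀ i, v i ≠ 0)
    {U V : Finset ι} (hUV : Disjoint U V)
    (hcross : ∀ i ∈ U, ∀ j ∈ V, ¬ IsMultipleLine v i j)
    (hU : HasPrimeFiltration (singularLines v U) (singularIdeal v U))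
    (hV : HasPrimeFiltration (singularLines v V) (singularIdeal v V))
    (hBU : ∏ i ∈ U, linearForm (v i) ∈ singularIdeal v U)
    (hGV : ∏ i ∈ V, linearForm (v i) ∈ singularIdeal v V) :
    HasPrimeFiltration (singularLines v (U ∪ V)) (singularIdeal v (U ∪ V)) := by
  have hne : ∀ i ∈ U, ∀ j ∈ V, i ≠ j := fun i hi j hj h ↦
    Finset.disjoint_left.1 hUV hi (h ▸ hj)
  have hmult : ∀ i ∈ U, ∀ j ∈ V, ∀ c, c ≠ i → c ≠ j → linearForm (v c) ∉ lineIdeal v i j :=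
    fun i hi j hj c hci hcj hc ↦ hcross i hi j hj ⟨c, hci, hcj, hc⟩
  have hsimple : ∀ i ∈ U, ∀ j ∈ V, lineComponent v (lineIdeal v i j) = lineIdeal v i j := by
    intro i hi j hj
    refine lineComponent_eq_of_simple hv (hne i hi j hj) fun c hc ↦ ?_
    by_contra! h
    exact hmult i hi j hj c h.1 h.2 hc
  -- A plane of `U` contains no singular line of `V`, and conversely.
  have hnotV : ∀ i ∈ U, ∀ j ∈ V, ∀ j' ∈ V, j ≠ j' → linearForm (v i) ∉ lineIdeal v j j' := by
    intro i hi j hj j' hj' hjj' h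
    have := lineIdeal_eq hv hjj' (hne i hi j hj) h (left_mem_lineIdeal j j')
    exact hmult i hi j hj j' (hne i hi j' hj').symm hjj'.symm (this ▸ right_mem_lineIdeal j j')
  have hnotU : ∀ j ∈ V, ∀ i ∈ U, ∀ i' ∈ U, i ≠ i' → linearForm (v j) ∉ lineIdeal v i i' := by
    intro j hj i hi i' hi' hii' h
    have := lineIdeal_eq hv hii' (hne i hi j hj) (left_mem_lineIdeal i i') h
    exact hmult i hi j hj i' hii'.symm (hne i' hi' j hj) (this ▸ right_mem_lineIdeal i i')
  obtain ⟨h₁, h₂⟩ := span_pair_prod (fun i ↦ linearForm (v i)) U V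
    (fun i ↦ linearForm_ne_zero (hv0 i))
    (fun i hi j hj ↦ linearForm_isRelPrime hv (hne i hi j hj))
    (fun i hi j hj ↦ lineIdeal_isPrime hv (hne i hi j hj))
    (fun i hi i' hi' j hj h ↦ hmult i' hi' j hj i h (hne i hi j hj))
    (fun i hi j hj j' hj' h ↦ hmult i hi j' hj' j (hne i hi j hj).symm h)
  have hsub : {P | ∃ a ∈ U, ∃ b ∈ V, P = Ideal.span {linearForm (v a), linearForm (v b)}} ⊆
      singularLines v (U ∪ V) := fun P ⟨a, ha, b, hb, e⟩ ↦
    ⟨a, Finset.mem_union_left _ ha, b, Finset.mem_union_right _ hb, hne a ha b hb, e⟩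
  have hunion : singularIdeal v (U ∪ V) = singularIdeal v U ⊓ singularIdeal v V ⊓
      Ideal.span {∏ i ∈ U, linearForm (v i), ∏ i ∈ V, linearForm (v i)} := by
    have hspan : ∀ i ∈ U, ∀ j ∈ V,
        Ideal.span {∏ i ∈ U, linearForm (v i), ∏ i ∈ V, linearForm (v i)} ≤ lineIdeal v i j := by
      intro i hi j hj
      refine Ideal.span_le.2 ?_
      rintro _ (rfl | rfl)
      · exact Ideal.mem_of_dvd _ (Finset.dvd_prod_of_mem _ hi) (left_mem_lineIdeal i j)
      · exact Ideal.mem_of_dvd _ (Finset.dvd_prod_of_mem _ hj) (right_mem_lineIdeal i j)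
    ext x
    simp only [Submodule.mem_inf, mem_singularIdeal]
    constructor
    · intro h
      refine ⟨⟨fun a ha b hb ↦ h a (Finset.mem_union_left _ ha) b (Finset.mem_union_left _ hb),
        fun a ha b hb ↦ h a (Finset.mem_union_right _ ha) b (Finset.mem_union_right _ hb)⟩,
        h₂ x fun a ha b hb ↦ ?_⟩
      have := h a (Finset.mem_union_left _ ha) b (Finset.mem_union_right _ hb) (hne a ha b hb)
      rwa [hsimple a ha b hb] at this
    · rintro ⟨⟨hxU, hxV⟩, hx⟩ a ha b hb hab
      rcases Finset.mem_union.1 ha with ha | ha <;> rcases Finset.mem_union.1 hb with hb | hb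
      · exact hxU a ha b hb hab
      · rw [hsimple a ha b hb]
        exact hspan a ha b hb hx
      · rw [lineIdeal_comm, hsimple b hb a ha]
        exact hspan b hb a ha hx
      · exact hxV a ha b hb hab
  rw [hunion, inf_inf_span_pair_eq hBU hGV]
  · refine HasPrimeFiltration.liaison_addition
      (hU.mono (singularLines_mono Finset.subset_union_left))
      (hV.mono (singularLines_mono Finset.subset_union_right)) (h₁.mono hsub) hBU hGV ?_
    exact IsRelPrime.prod_left fun i hi ↦ IsRelPrime.prod_right fun j hj ↦
      linearForm_isRelPrime hv (hne i hi j hj)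
  · refine fun x hx ↦ hU.mem_of_mul_mem ?_ hx
    rintro P ⟨a, ha, b, hb, hab, rfl⟩
    have hP := lineIdeal_isPrime hv hab
    refine ⟨hP, fun h ↦ ?_⟩
    obtain ⟨j, hj, hj'⟩ := hP.prod_mem_iff.1 h
    exact hnotU j hj a ha b hb hab hj'
  · refine fun x hx ↦ hV.mem_of_mul_mem ?_ hx
    rintro P ⟨a, ha, b, hb, hab, rfl⟩
    have hP := lineIdeal_isPrime hv hab
    refine ⟨hP, fun h ↦ ?_⟩
    obtain ⟨j, hj, hj'⟩ := hP.prod_mem_iff.1 h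
    exact hnotV j hj a ha b hb hab hj'

/-- If every plane contains at most one multiple line, then the one-dimensional part of the singular
scheme of an arrangement is filtered by coordinate rings of lines. -/
lemma hasPrimeFiltration_singularIdeal [CharZero k]
    (hv : Pairwise fun i j ↦ LinearIndependent k ![v i, v j]) (hv0 : ∀ i, v i ≠ 0)
    (hmult : ∀ a b a' b' i, a ≠ b → a' ≠ b' → IsMultipleLine v a b → IsMultipleLine v a' b' →
      linearForm (v i) ∈ lineIdeal v a b → linearForm (v i) ∈ lineIdeal v a' b' →
      lineIdeal v a b = lineIdeal v a' b')
    (U : Finset ι) (hsat : IsSaturated v U) :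
    HasPrimeFiltration (singularLines v U) (singularIdeal v U) := by
  classical
  induction U using Finset.strongInduction with
  | H U ih =>
  rcases U.eq_empty_or_nonempty with rfl | ⟨a, ha⟩
  · have : singularIdeal v (∅ : Finset ι) = ⊤ := by simp [singularIdeal]
    rw [this]
    exact .top
  -- The block of `a`: all planes through the multiple line in `a`, or `a` alone.
  obtain ⟨V, haV, hVU, hcross, hV, hGV⟩ : ∃ V : Finset ι, a ∈ V ∧ V ⊆ U ∧
      (∀ i ∉ V, ∀ j ∈ V, ¬ IsMultipleLine v i j) ∧
      HasPrimeFiltration (singularLines v V) (singularIdeal v V) ∧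
      ∏ i ∈ V, linearForm (v i) ∈ singularIdeal v V := by
    by_cases hex : ∃ b, a ≠ b ∧ IsMultipleLine v a b
    · obtain ⟨b, hab, hm⟩ := hex
      have hI : singularIdeal v (planesThrough v (lineIdeal v a b)) =
          lineComponent v (lineIdeal v a b) := by
        ext x
        rw [mem_singularIdeal]
        constructor
        · exact fun h ↦ h a (mem_planesThrough.2 (left_mem_lineIdeal a b)) b
            (mem_planesThrough.2 (right_mem_lineIdeal a b)) hab
        · intro h c hc e he hce
          rwa [lineIdeal_eq hv hab hce (mem_planesThrough.1 hc) (mem_planesThrough.1 he)]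
      refine ⟨planesThrough v (lineIdeal v a b), mem_planesThrough.2 (left_mem_lineIdeal a b),
        ?_, ?_, ?_, ?_⟩
      · intro i hi
        rw [mem_planesThrough] at hi
        by_cases hia : i = a
        · exact hia ▸ ha
        by_cases hib : i = b
        · obtain ⟨c, hca, hcb, hc⟩ := hm
          exact hib ▸ hsat a b c hab hca hcb hc ha
        · have := lineIdeal_eq hv hab (Ne.symm hia) (left_mem_lineIdeal a b) hi
          exact hsat a i b (Ne.symm hia) hab.symm (Ne.symm hib)
            (this ▸ right_mem_lineIdeal a b) ha
      · intro i hi j hj hij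
        rw [mem_planesThrough] at hi hj
        have hne : i ≠ j := fun h ↦ hi (h ▸ hj)
        have := hmult i j a b j hne hab hij hm (right_mem_lineIdeal i j) hj
        exact hi (this ▸ left_mem_lineIdeal i j)
      · rw [hI]
        refine (hasPrimeFiltration_lineComponent hv hab hv0).mono ?_
        rintro P rfl
        exact ⟨a, mem_planesThrough.2 (left_mem_lineIdeal a b), b,
          mem_planesThrough.2 (right_mem_lineIdeal a b), hab, rfl⟩
      · rw [hI]
        exact prod_mem_lineComponent a b
    · have hI : singularIdeal v {a} = ⊤ := by
        rw [Ideal.eq_top_iff_one, mem_singularIdeal]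
        intro c hc e he hce
        rw [Finset.mem_singleton] at hc he
        exact absurd (hc.trans he.symm) hce
      refine ⟨{a}, Finset.mem_singleton_self a, Finset.singleton_subset_iff.2 ha, ?_, ?_, ?_⟩
      · intro i hi j hj ⟨c, hci, hcj, hc⟩
        rw [Finset.mem_singleton] at hi hj
        subst hj
        exact hex ⟨i, Ne.symm hi, c, hcj, hci, by rwa [lineIdeal_comm]⟩
      · rw [hI]
        exact .top
      · rw [hI]
        trivial
  have hcross' : ∀ i ∈ U \ V, ∀ j ∈ V, ¬ IsMultipleLine v i j :=
    fun i hi ↦ hcross i (Finset.mem_sdiff.1 hi).2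
  have hsat' : IsSaturated v (U \ V) := by
    intro i j c hij hci hcj hc hi
    have hj := hsat i j c hij hci hcj hc (Finset.mem_sdiff.1 hi).1
    exact Finset.mem_sdiff.2 ⟨hj, fun hjV ↦ hcross' i hi j hjV ⟨c, hci, hcj, hc⟩⟩
  have hss : U \ V ⊂ U := by
    refine Finset.ssubset_iff_of_subset Finset.sdiff_subset |>.2 ⟨a, ha, fun h ↦ ?_⟩
    exact (Finset.mem_sdiff.1 h).2 haV
  have := hasPrimeFiltration_singularIdeal_union hv hv0 Finset.sdiff_disjoint hcross'
    (ih _ hss hsat') hV (prod_mem_singularIdeal hv hsat') hGV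
  rwa [Finset.sdiff_union_of_subset hVU] at this

end Arrangement

/-! ### The components of height two -/

lemma Ideal.height_radical {R : Type*} [CommRing R] (I : Ideal R) :
    I.radical.height = I.height := by
  rw [Ideal.height_eq_inf_minimalPrimes, Ideal.height_eq_inf_minimalPrimes,
    Ideal.radical_minimalPrimes]

section HeightTwo

variable {k : Type*} [Field k] {ι : Type*} [Fintype ι] {v : ι → Fin (3 + 1) → k}

lemma jacobianIdeal_le_lineIdeal {a b : ι} (hab : a ≠ b) :
    jacobianIdeal (∏ i, linearForm (v i)) ≤ lineIdeal v a b := by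
  classical
  have h := prod_linearForm_mem_pow_card v (Q := lineIdeal v a b) (t := {a, b})
    (s := Finset.univ) (Finset.subset_univ _)
    (by simp [left_mem_lineIdeal, right_mem_lineIdeal])
  rw [Finset.card_pair hab] at h
  simpa using jacobianIdeal_le_pow h

variable [CharZero k]

/-- Every prime ideal that contains the Jacobian ideal contains the ideal of a line in which two
planes of the arrangement meet. -/
lemma exists_lineIdeal_le [Nonempty ι] (hv0 : ∀ i, v i ≠ 0)
    {Q : Ideal (MvPolynomial (Fin (3 + 1)) k)} (hQ : Q.IsPrime)
    (h : jacobianIdeal (∏ i, linearForm (v i)) ≤ Q) : ∃ a b, a ≠ b ∧ lineIdeal v a b ≤ Q := by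
  obtain ⟨a, -, b, -, hab, ha, hb⟩ :=
    exists_ne_linearForm_mem_of_jacobianIdeal_le v hv0 Finset.univ_nonempty hQ h
  exact ⟨a, b, hab, lineIdeal_le ha hb⟩

lemma lineIdeal_mem_minimalPrimes (hv : Pairwise fun i j ↦ LinearIndependent k ![v i, v j])
    (hv0 : ∀ i, v i ≠ 0) {a b : ι} (hab : a ≠ b) :
    lineIdeal v a b ∈ (jacobianIdeal (∏ i, linearForm (v i))).minimalPrimes := by
  have : Nonempty ι := ⟨a⟩
  refine ⟨⟨lineIdeal_isPrime hv hab, jacobianIdeal_le_lineIdeal hab⟩, fun Q hQ hle ↦ ?_⟩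
  obtain ⟨c, e, hce, h⟩ := exists_lineIdeal_le hv0 hQ.1 hQ.2
  rw [← eq_lineIdeal_of_le_of_height hv hce (lineIdeal_isPrime hv hab)
    (lineIdeal_height hv hab).le (h.trans hle)]
  exact h

/-- The component of the Jacobian ideal along a line is the Jacobian ideal of the product `G` of the
planes through the line, because the product `H` of the other planes is a unit at the line. -/
lemma eq_lineComponent (hv : Pairwise fun i j ↦ LinearIndependent k ![v i, v j])
    (hv0 : ∀ i, v i ≠ 0) {t : Finset (Ideal (MvPolynomial (Fin (3 + 1)) k))}
    (ht : Submodule.IsMinimalPrimaryDecomposition (jacobianIdeal (∏ i, linearForm (v i))) t)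
    {q : Ideal (MvPolynomial (Fin (3 + 1)) k)} (hq : q ∈ t) {a b : ι} (hab : a ≠ b)
    (hrad : q.radical = lineIdeal v a b) : q = lineComponent v (lineIdeal v a b) := by
  classical
  have hP := lineIdeal_isPrime hv hab
  have hmem : ∀ x, x ∈ q ↔ ∃ s ∉ lineIdeal v a b,
      s * x ∈ jacobianIdeal (∏ i, linearForm (v i)) := by
    intro x
    rw [mem_iff_of_isMinimalPrimaryDecomposition ht hq
      (hrad ▸ lineIdeal_mem_minimalPrimes hv hv0 hab), hrad]
  set V := planesThrough v (lineIdeal v a b) with hV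
  have hprod : ∏ i, linearForm (v i) =
      (∏ i ∈ V, linearForm (v i)) * ∏ i ∈ Vᶜ, linearForm (v i) :=
    (Finset.prod_mul_prod_compl V _).symm
  have hF : ∏ i, linearForm (v i) ∈ jacobianIdeal (∏ i, linearForm (v i)) :=
    prod_linearForm_mem_jacobianIdeal v ⟨a, Finset.mem_univ a⟩
  rw [hprod] at hmem hF
  have hH : ∏ i ∈ Vᶜ, linearForm (v i) ∉ lineIdeal v a b := by
    intro h
    obtain ⟨i, hi, hi'⟩ := hP.prod_mem_iff.1 h
    exact Finset.mem_compl.1 hi (mem_planesThrough.2 hi')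
  apply le_antisymm
  · intro x hx
    obtain ⟨s, hs, hsx⟩ := (hmem x).1 hx
    refine (hasPrimeFiltration_lineComponent hv hab hv0).mem_of_mul_mem (s := s) ?_
      (jacobianIdeal_mul_le_left (prod_mem_lineComponent a b) hsx)
    rintro P rfl
    exact ⟨hP, hs⟩
  · refine Ideal.span_le.2 ?_
    rintro _ ⟨j, rfl⟩
    exact (hmem _).2 ⟨_, fun h ↦ hH (hP.mem_of_pow_mem 2 h), sq_mul_pderiv_mem_jacobianIdeal hF j⟩

lemma lineComponent_mem_heightTwoComponents
    (hv : Pairwise fun i j ↦ LinearIndependent k ![v i, v j])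
    (hv0 : ∀ i, v i ≠ 0) {t : Finset (Ideal (MvPolynomial (Fin (3 + 1)) k))}
    (ht : Submodule.IsMinimalPrimaryDecomposition (jacobianIdeal (∏ i, linearForm (v i))) t)
    {a b : ι} (hab : a ≠ b) :
    lineComponent v (lineIdeal v a b) ∈ heightTwoComponents t ∧
      (lineComponent v (lineIdeal v a b)).radical = lineIdeal v a b := by
  obtain ⟨q, hq, hrad⟩ :=
    Ideal.IsMinimalPrimaryDecomposition.minimalPrimes_subset_image_radical ht
      (lineIdeal_mem_minimalPrimes hv hv0 hab)
  have h := eq_lineComponent hv hv0 ht hq hab hrad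
  rw [← h]
  refine ⟨⟨hq, ?_⟩, hrad⟩
  rw [← Ideal.height_radical, hrad, lineIdeal_height hv hab]

lemma exists_eq_lineComponent (hv : Pairwise fun i j ↦ LinearIndependent k ![v i, v j])
    (hv0 : ∀ i, v i ≠ 0) {t : Finset (Ideal (MvPolynomial (Fin (3 + 1)) k))}
    (ht : Submodule.IsMinimalPrimaryDecomposition (jacobianIdeal (∏ i, linearForm (v i))) t)
    {q : Ideal (MvPolynomial (Fin (3 + 1)) k)} (hq : q ∈ heightTwoComponents t) :
    ∃ a b, a ≠ b ∧ q = lineComponent v (lineIdeal v a b) := by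
  classical
  obtain ⟨hqt, hht⟩ := hq
  have hprime : q.radical.IsPrime := Ideal.isPrime_radical (ht.primary hqt)
  rcases isEmpty_or_nonempty ι with hι | hι
  · -- The Jacobian ideal of the empty arrangement is zero, hence so is its only component.
    exfalso
    have hJ : jacobianIdeal (∏ i, linearForm (v i)) = ⊥ := by
      rw [jacobianIdeal, Ideal.span_eq_bot]
      rintro _ ⟨j, rfl⟩
      simp
    obtain ⟨q', hq', hrad⟩ :=
      Ideal.IsMinimalPrimaryDecomposition.minimalPrimes_subset_image_radical ht
        (show ⊥ ∈ _ by rw [hJ]; exact ⟨⟨Ideal.isPrime_bot, le_rfl⟩, fun _ _ _ ↦ bot_le⟩)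
    have hq'bot : q' = ⊥ := le_bot_iff.1 (Ideal.le_radical.trans hrad.le)
    have : q' = q := by
      by_contra hne
      refine ht.minimal hqt ((Finset.inf_le (Finset.mem_erase.2 ⟨hne, hq'⟩)).trans ?_)
      rw [id, hq'bot]
      exact bot_le
    rw [← this, hq'bot, Ideal.height_bot] at hht
    exact absurd hht (by decide)
  · obtain ⟨a, b, hab, hle⟩ := exists_lineIdeal_le hv0 hprime
      ((ht.inf_eq.symm.trans_le (Finset.inf_le hqt)).trans Ideal.le_radical)
    have hrad := eq_lineIdeal_of_le_of_height hv hab hprime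
      (by rw [Ideal.height_radical, hht]) hle
    exact ⟨a, b, hab, eq_lineComponent hv hv0 ht hqt hab hrad.symm⟩

lemma topDimensionalPart_eq_singularIdeal
    (hv : Pairwise fun i j ↦ LinearIndependent k ![v i, v j])
    (hv0 : ∀ i, v i ≠ 0) {t : Finset (Ideal (MvPolynomial (Fin (3 + 1)) k))}
    (ht : Submodule.IsMinimalPrimaryDecomposition (jacobianIdeal (∏ i, linearForm (v i))) t) :
    topDimensionalPart t = singularIdeal v Finset.univ := by
  ext x
  rw [mem_singularIdeal, topDimensionalPart, Submodule.mem_sInf]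
  constructor
  · intro h a _ b _ hab
    exact h _ (lineComponent_mem_heightTwoComponents hv hv0 ht hab).1
  · intro h q hq
    obtain ⟨a, b, hab, rfl⟩ := exists_eq_lineComponent hv hv0 ht hq
    exact h a (Finset.mem_univ a) b (Finset.mem_univ b) hab

end HeightTwo

theorem theorem3p2 {k : Type*} [Field k] [CharZero k] {d : ℕ}
    (L : Fin d → MvPolynomial (Fin (3 + 1)) k) (hL : IsHyperplaneArrangement L)
    (t : Finset (Ideal (MvPolynomial (Fin (3 + 1)) k)))
    (ht : Submodule.IsMinimalPrimaryDecomposition (jacobianIdeal (∏ i, L i)) t)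
    (h : ∀ i, ∀ q ∈ heightTwoComponents t, ∀ q' ∈ heightTwoComponents t,
      ¬ q.IsRadical → ¬ q'.IsRadical → L i ∈ q.radical → L i ∈ q'.radical → q = q') :
    IsCohenMacaulayRing (MvPolynomial (Fin (3 + 1)) k ⧸ topDimensionalPart t) ∧
      DefinesACMScheme (topDimensionalPart t) := by
  choose v hvL using fun i ↦ exists_linearForm_eq (hL.linear i)
  obtain rfl : L = fun i ↦ linearForm (v i) := (funext hvL).symm
  have hv0 : ∀ i, v i ≠ 0 := fun i hi ↦ hL.ne_zero i (by simp [hi])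
  have hv : Pairwise fun i j ↦ LinearIndependent k ![v i, v j] := by
    intro i j hij
    refine LinearIndependent.of_comp linearForm ?_
    convert hL.distinct i j hij using 1
    ext l
    fin_cases l <;> rfl
  have hcomp := fun {a b : Fin d} (hab : a ≠ b) ↦
    lineComponent_mem_heightTwoComponents hv hv0 ht hab
  have hnonrad : ∀ a b, a ≠ b → IsMultipleLine v a b →
      ¬ (lineComponent v (lineIdeal v a b)).IsRadical := by
    rintro a b hab ⟨c, hca, hcb, hc⟩
    exact lineComponent_not_isRadical hv hab hv0 hca hcb hc (hcomp hab).2.ge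
  have hfil : HasPrimeFiltration (singularLines v Finset.univ) (topDimensionalPart t) := by
    rw [topDimensionalPart_eq_singularIdeal hv hv0 ht]
    refine hasPrimeFiltration_singularIdeal hv hv0 ?_ _ fun _ b _ _ _ _ _ _ ↦ Finset.mem_univ b
    intro a b a' b' i hab hab' hm hm' hi hi'
    have he := h i _ (hcomp hab).1 _ (hcomp hab').1 (hnonrad a b hab hm)
      (hnonrad a' b' hab' hm') (by rwa [(hcomp hab).2]) (by rwa [(hcomp hab').2])
    exact (hcomp hab).2.symm.trans ((congrArg Ideal.radical he).trans (hcomp hab').2)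
  have hprime : ∀ P ∈ singularLines v Finset.univ, P.IsPrime := by
    rintro P ⟨a, -, b, -, hab, rfl⟩
    exact lineIdeal_isPrime hv hab
  have hsat : saturation (topDimensionalPart t) = topDimensionalPart t := by
    refine hfil.saturation_eq fun P hP ↦ ⟨hprime P hP, fun hle ↦ ?_⟩
    obtain ⟨a, -, b, -, hab, rfl⟩ := hP
    have hmax : (Ideal.span (Set.range X) : Ideal (MvPolynomial (Fin (3 + 1)) k)).IsMaximal := by
      rw [← idealOfVars, ← MvPolynomial.ker_constantCoeff_eq_idealOfVars]
      exact MvPolynomial.ker_constantCoeff_isMaximal _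
    refine lineIdeal_not_isMaximal hv hab ?_
    rwa [← hmax.eq_of_le (lineIdeal_isPrime hv hab).ne_top hle]
  have hCM : IsCohenMacaulayRing (MvPolynomial (Fin (3 + 1)) k ⧸ topDimensionalPart t) := by
    refine hfil.isCohenMacaulayRing_quotient ?_ hprime ?_ ?_
    · refine (Set.finite_range fun p : Fin d × Fin d ↦ lineIdeal v p.1 p.2).subset ?_
      rintro P ⟨a, -, b, -, -, rfl⟩
      exact ⟨(a, b), rfl⟩
    · rintro P ⟨a, -, b, -, hab, rfl⟩
      exact lineIdeal_uniqueFactorizationMonoid hv hab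
    · rintro P ⟨a, -, b, -, hab, rfl⟩
      exact lineIdeal_quotient_height hv hab
  refine ⟨hCM, ?_⟩
  rw [DefinesACMScheme, hsat]
  exact hCM
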